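/- Let $n\ge 2$. There exist $v\in L^\infty(\mathbb{R}^n_x\times\mathbb{R}_t;\mathbb{R}^n)$ and $p\in L^\infty(\mathbb{R}^n_x\times\mathbb{R}_t)$ which solve the incompressible Euler equations without external force, $$\partial_t v+\operatorname{div}(v\otimes v)+\nabla p=0,\qquad \operatorname{div} v=0,$$ in the sense of distributions on $\mathbb{R}^n_x\times\mathbb{R}_t$, that is, $$\int\Big(v\cdot\partial_t\varphi+\sum_{i,j=1}^n v_iv_j\,\partial_{x_j}\varphi_i+p\,\operatorname{div}_x\varphi\Big)\,dx\,dt=0,\qquad \int v\cdot\nabla_x\psi\,dx\,dt=0$$ for all $\varphi\in C_c^\infty(\mathbb{R}^n\times\mathbb{R};\mathbb{R}^n)$ and all $\psi\in C_c^\infty(\mathbb{R}^n\times\mathbb{R})$, such that $v$ is not identically zero (as an element of $L^\infty$), $\operatorname{supp} v$ and $\operatorname{supp} p$ are compact in $\mathbb{R}^n_x\times\mathbb{R}_t$, and moreover - $\int_{\mathbb{R}^n}|v(x,t)|^2\,dx=1$ for almost every $t\in(-1,1)$, - $v(x,t)=0$ for $|t|>1$. -/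

import Mathlib

open MeasureTheory
open scoped ContDiff

/-- Space-time `ℝⁿ × ℝ`; a point is `(x, t)`. Its `volume` is Lebesgue measure `dx dt`. -/
abbrev SpaceTime (n : ℕ) : Type := EuclideanSpace ℝ (Fin n) × ℝ

/-- The partial derivative `∂ₜ φ (y)` at the space-time point `y`. -/
noncomputable def timeDeriv {n : ℕ} {F : Type*} [NormedAddCommGroup F] [NormedSpace ℝ F]
    (φ : SpaceTime n → F) (y : SpaceTime n) : F :=
  fderiv ℝ φ y (0, 1)

/-- The partial derivative `∂φ/∂xⱼ (y)` at the space-time point `y`. -/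
noncomputable def spaceDeriv {n : ℕ} {F : Type*} [NormedAddCommGroup F] [NormedSpace ℝ F]
    (j : Fin n) (φ : SpaceTime n → F) (y : SpaceTime n) : F :=
  fderiv ℝ φ y (EuclideanSpace.single j 1, 0)

/-- `(v, p)` solves the incompressible Euler equations with force `f`,
`∂ₜ v + div (v ⊗ v) + ∇ p - f = 0` and `div v = 0`, in the sense of distributions on
`ℝⁿ × ℝ`. All the terms are distributions because `v`, `|v|²`, `p` and `f` are locally
integrable. -/
structure IsDistributionalEulerSolution {n : ℕ}
    (f v : SpaceTime n → EuclideanSpace ℝ (Fin n)) (p : SpaceTime n → ℝ) : Prop where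
  locallyIntegrable_force : LocallyIntegrable f volume
  locallyIntegrable_velocity : LocallyIntegrable v volume
  locallyIntegrable_velocity_sq : LocallyIntegrable (fun y => ‖v y‖ ^ 2) volume
  locallyIntegrable_pressure : LocallyIntegrable p volume
  momentum : ∀ φ : SpaceTime n → EuclideanSpace ℝ (Fin n),
    ContDiff ℝ ∞ φ → HasCompactSupport φ →
      ∫ y, ((∑ i, v y i * timeDeriv φ y i)
        + (∑ i, ∑ j, v y i * v y j * spaceDeriv j φ y i)
        + p y * (∑ i, spaceDeriv i φ y i)
        + ∑ i, f y i * φ y i) = 0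
  incompressible : ∀ ψ : SpaceTime n → ℝ,
    ContDiff ℝ ∞ ψ → HasCompactSupport ψ →
      ∫ y, (∑ i, v y i * spaceDeriv i ψ y) = 0

open Filter Set Topology
open scoped RealInnerProductSpace Matrix Matrix.Norms.Elementwise

/-!
The proof is by convex integration. The Euler equations are the linear system
`∂ₜ v + div u + ∇ q = 0`, `div v = 0` together with the pointwise constraint
`v ⊗ v - u = (e / n) Id`, `|v|² = e`. Subsolutions, whose states satisfy a strict matrix inequality
instead of the constraint, admit localized plane wave perturbations oscillating along a direction
of the wave cone. Where the energy defect `e - |v|²` has size `d`, a wave of amplitude comparable to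
`d` fits, so covering the domain by small balls raises the total energy by a fixed fraction of the
squared total defect. Iterating, the energies converge and the defects tend to zero; since the
perturbations oscillate fast, each is almost orthogonal to all earlier velocities, so convergence of
the energies makes the velocities Cauchy in `L²`. In the limit `|v|² = e` almost everywhere, the
matrix inequality is then forced to be an equality, and the limit solves the Euler equations with
the pressure shifted by `e / n`.
-/

section DirectionalDerivative

variable {V F : Type*} [NormedAddCommGroup V] [NormedSpace ℝ V]
  [NormedAddCommGroup F] [NormedSpace ℝ F]

/-- The derivative `∂ₐ f` as a function of the base point, so that derivatives can be iterated. -/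
noncomputable def dirDeriv (a : V) (f : V → F) (y : V) : F := fderiv ℝ f y a

theorem contDiff_dirDeriv {f : V → F} (hf : ContDiff ℝ ∞ f) (a : V) :
    ContDiff ℝ ∞ (dirDeriv a f) :=
  (hf.fderiv_right (m := ∞) (by simp)).clm_apply contDiff_const

theorem tsupport_dirDeriv_subset (a : V) (f : V → F) : tsupport (dirDeriv a f) ⊆ tsupport f :=
  tsupport_fderiv_apply_subset ℝ a

theorem hasCompactSupport_dirDeriv {f : V → F} (hf : HasCompactSupport f) (a : V) :
    HasCompactSupport (dirDeriv a f) :=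
  hf.fderiv_apply ℝ a

theorem dirDeriv_comm {f : V → F} (hf : ContDiff ℝ ∞ f) (a b : V) :
    dirDeriv a (dirDeriv b f) = dirDeriv b (dirDeriv a f) := by
  have hd : Differentiable ℝ (fderiv ℝ f) :=
    (hf.fderiv_right (m := ∞) (by simp)).differentiable (by simp)
  have second (a b y : V) : dirDeriv a (dirDeriv b f) y = fderiv ℝ (fderiv ℝ f) y a b := by
    have : HasFDerivAt (dirDeriv b f) _ y := (hd y).hasFDerivAt.clm_apply (hasFDerivAt_const b y)
    rw [dirDeriv, this.fderiv]
    simp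
  funext y
  rw [second, second]
  exact second_derivative_symmetric (fun y => (hf.differentiable (by simp) y).hasFDerivAt)
    (hd y).hasFDerivAt a b

variable [MeasurableSpace V] [BorelSpace V] {μ : Measure V} [μ.IsAddHaarMeasure]

theorem integrable_dirDeriv_mul_dirDeriv {h f : V → ℝ} (hh : ContDiff ℝ ∞ h)
    (hf : ContDiff ℝ ∞ f) (hfc : HasCompactSupport f) (a c : V) :
    Integrable (fun y => dirDeriv a h y * dirDeriv c f y) μ :=
  ((contDiff_dirDeriv hh a).continuous.mul (contDiff_dirDeriv hf c).continuous
    ).integrable_of_hasCompactSupport (hasCompactSupport_dirDeriv hfc c).mul_left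

/-- The Jacobian determinant of `(h, f)` in the plane spanned by `a` and `c`. -/
noncomputable def jacobian (h f : V → ℝ) (a c y : V) : ℝ :=
  dirDeriv a h y * dirDeriv c f y - dirDeriv c h y * dirDeriv a f y

theorem integrable_jacobian {h f : V → ℝ} (hh : ContDiff ℝ ∞ h)
    (hf : ContDiff ℝ ∞ f) (hfc : HasCompactSupport f) (a c : V) :
    Integrable (jacobian h f a c) μ :=
  (integrable_dirDeriv_mul_dirDeriv hh hf hfc a c).sub
    (integrable_dirDeriv_mul_dirDeriv hh hf hfc c a)

variable [FiniteDimensional ℝ V]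

theorem integral_mul_dirDeriv {f g : V → ℝ} (hf : ContDiff ℝ ∞ f) (hg : ContDiff ℝ ∞ g)
    (hgc : HasCompactSupport g) (a : V) :
    ∫ y, f y * dirDeriv a g y ∂μ = -∫ y, dirDeriv a f y * g y ∂μ := by
  have integrable_mul {p q : V → ℝ} (hp : ContDiff ℝ ∞ p) (hq : ContDiff ℝ ∞ q)
      (hqc : HasCompactSupport q) : Integrable (fun y => p y * q y) μ :=
    (hp.continuous.mul hq.continuous).integrable_of_hasCompactSupport hqc.mul_left
  exact integral_mul_fderiv_eq_neg_fderiv_mul_of_integrable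
    (integrable_mul (contDiff_dirDeriv hf a) hg hgc)
    (integrable_mul hf (contDiff_dirDeriv hg a) (hasCompactSupport_dirDeriv hgc a))
    (integrable_mul hf hg hgc)
    (fun x _ => hf.differentiable (by simp) x) (fun x _ => hg.differentiable (by simp) x)

theorem integral_jacobian {h f : V → ℝ} (hh : ContDiff ℝ ∞ h)
    (hf : ContDiff ℝ ∞ f) (hfc : HasCompactSupport f) (a c : V) :
    ∫ y, jacobian h f a c y ∂μ = 0 := by
  have hac := integral_mul_dirDeriv (μ := μ) hh (contDiff_dirDeriv hf c)
    (hasCompactSupport_dirDeriv hfc c) a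
  have hca := integral_mul_dirDeriv (μ := μ) hh (contDiff_dirDeriv hf a)
    (hasCompactSupport_dirDeriv hfc a) c
  rw [dirDeriv_comm hf] at hac
  simp only [jacobian]
  rw [integral_sub (integrable_dirDeriv_mul_dirDeriv hh hf hfc a c)
    (integrable_dirDeriv_mul_dirDeriv hh hf hfc c a)]
  linarith

end DirectionalDerivative

section Oscillation

variable {V : Type*} [NormedAddCommGroup V] [NormedSpace ℝ V]

/-- The scalar potential of a localized plane wave with envelope `χ`, phase `ℓ` and frequency `N`;
the factor `-N⁻²` makes its second derivatives of order one. -/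
noncomputable def wavePotential (χ : V → ℝ) (ℓ : V →L[ℝ] ℝ) (N : ℝ) (y : V) : ℝ :=
  -(χ y * Real.cos (N * ℓ y)) / N ^ 2

theorem contDiff_wavePotential {χ : V → ℝ} (hχ : ContDiff ℝ ∞ χ) (ℓ : V →L[ℝ] ℝ) (N : ℝ) :
    ContDiff ℝ ∞ (wavePotential χ ℓ N) := by
  unfold wavePotential
  fun_prop

theorem tsupport_wavePotential_subset (χ : V → ℝ) (ℓ : V →L[ℝ] ℝ) (N : ℝ) :
    tsupport (wavePotential χ ℓ N) ⊆ tsupport χ := by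
  refine closure_mono fun y hy hχ => hy ?_
  simp [wavePotential, hχ]

theorem dirDeriv_wavePotential {χ : V → ℝ} (hχ : ContDiff ℝ ∞ χ) (ℓ : V →L[ℝ] ℝ)
    (N : ℝ) (b : V) :
    dirDeriv b (wavePotential χ ℓ N) = fun y =>
      -(dirDeriv b χ y * Real.cos (N * ℓ y) - χ y * (N * ℓ b * Real.sin (N * ℓ y))) / N ^ 2 := by
  funext y
  have hχ' : HasFDerivAt χ (fderiv ℝ χ y) y := (hχ.differentiable (by simp) y).hasFDerivAt
  have hℓ : HasFDerivAt (fun y => N * ℓ y) (N • ℓ) y := ℓ.hasFDerivAt.const_mul N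
  have h : HasFDerivAt (wavePotential χ ℓ N) _ y := (hχ'.mul hℓ.cos).neg.mul_const (N ^ 2)⁻¹
  rw [dirDeriv, h.fderiv]
  simp only [dirDeriv, smul_apply, neg_apply, add_apply, smul_eq_mul]
  ring

theorem dirDeriv_dirDeriv_wavePotential {χ : V → ℝ} (hχ : ContDiff ℝ ∞ χ)
    (ℓ : V →L[ℝ] ℝ) {N : ℝ} (hN : N ≠ 0) (a b y : V) :
    dirDeriv a (dirDeriv b (wavePotential χ ℓ N)) y =
      χ y * Real.cos (N * ℓ y) * (ℓ a * ℓ b)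
      + (ℓ b * dirDeriv a χ y + ℓ a * dirDeriv b χ y) * Real.sin (N * ℓ y) / N
      - dirDeriv a (dirDeriv b χ) y * Real.cos (N * ℓ y) / N ^ 2 := by
  have hχ' : HasFDerivAt χ (fderiv ℝ χ y) y := (hχ.differentiable (by simp) y).hasFDerivAt
  have hχb : HasFDerivAt (dirDeriv b χ) (fderiv ℝ (dirDeriv b χ) y) y :=
    ((contDiff_dirDeriv hχ b).differentiable (by simp) y).hasFDerivAt
  have hℓ : HasFDerivAt (fun y => N * ℓ y) (N • ℓ) y := ℓ.hasFDerivAt.const_mul N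
  have h := ((hχb.mul hℓ.cos).sub (hχ'.mul (hℓ.sin.const_mul (N * ℓ b)))).neg.mul_const
    (N ^ 2)⁻¹
  rw [dirDeriv, (h.congr_of_eventuallyEq (.of_eq (dirDeriv_wavePotential hχ ℓ N b))).fderiv]
  simp only [dirDeriv, smul_apply, neg_apply, add_apply, sub_apply, smul_eq_mul]
  field

theorem tendstoUniformly_dirDeriv_dirDeriv_wavePotential {χ : V → ℝ} (hχ : ContDiff ℝ ∞ χ)
    (hχc : HasCompactSupport χ) (ℓ : V →L[ℝ] ℝ) (a b : V) :
    TendstoUniformly (fun (N : ℝ) y => dirDeriv a (dirDeriv b (wavePotential χ ℓ N)) y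
      - χ y * Real.cos (N * ℓ y) * (ℓ a * ℓ b)) 0 atTop := by
  have bound (c : V) : ∃ A, ∀ y, ‖dirDeriv c χ y‖ ≤ A :=
    (hasCompactSupport_dirDeriv hχc c).exists_bound_of_continuous
      (contDiff_dirDeriv hχ c).continuous
  obtain ⟨A, hA⟩ := bound a
  obtain ⟨B, hB⟩ := bound b
  obtain ⟨C, hC⟩ : ∃ C, ∀ y, ‖dirDeriv a (dirDeriv b χ) y‖ ≤ C :=
    (hasCompactSupport_dirDeriv (hasCompactSupport_dirDeriv hχc b) a).exists_bound_of_continuous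
      (contDiff_dirDeriv (contDiff_dirDeriv hχ b) a).continuous
  have hlim : Tendsto (fun N : ℝ => (‖ℓ b‖ * A + ‖ℓ a‖ * B) / N + C / N ^ 2) atTop (𝓝 0) := by
    simpa using (tendsto_const_nhds.div_atTop tendsto_id).add
      (tendsto_const_nhds.div_atTop (tendsto_pow_atTop (α := ℝ) two_ne_zero))
  refine Metric.tendstoUniformly_iff.2 fun ε hε => ?_
  filter_upwards [hlim.eventually_lt_const hε, eventually_gt_atTop 0] with N hNε hN y
  refine lt_of_le_of_lt ?_ hNε
  rw [dirDeriv_dirDeriv_wavePotential hχ ℓ hN.ne', Pi.zero_apply, dist_zero_left, add_sub_assoc,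
    add_sub_cancel_left]
  refine (norm_sub_le _ _).trans (add_le_add ?_ ?_)
  · rw [norm_div, norm_mul, Real.norm_of_nonneg hN.le]
    gcongr
    refine (mul_le_of_le_one_right (norm_nonneg _) (Real.abs_sin_le_one _)).trans
      ((norm_add_le _ _).trans ?_)
    rw [norm_mul, norm_mul]
    gcongr <;> apply_assumption
  · rw [norm_div, norm_mul, Real.norm_of_nonneg (by positivity : (0 : ℝ) ≤ N ^ 2)]
    gcongr
    exact (mul_le_of_le_one_right (norm_nonneg _) (Real.abs_cos_le_one _)).trans (hC y)

variable [MeasurableSpace V] [BorelSpace V] [FiniteDimensional ℝ V] {μ : Measure V}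

section RiemannLebesgue

variable [μ.IsAddHaarMeasure] {ℓ : V →L[ℝ] ℝ}

theorem tendsto_integral_cos_mul (hℓ : ℓ ≠ 0) {f : V → ℝ} (hf : Integrable f μ) :
    Tendsto (fun N : ℝ => ∫ y, Real.cos (N * ℓ y) * f y ∂μ) atTop (𝓝 0) := by
  have hfreq : Tendsto (fun N : ℝ => (-(N / (2 * Real.pi))) • ℓ) atTop
      (cocompact (StrongDual ℝ V)) := by
    rw [← Metric.cobounded_eq_cocompact, ← tendsto_norm_atTop_iff_cobounded]
    have hpos : 0 < ‖ℓ‖ / (2 * Real.pi) := by positivity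
    refine (tendsto_id.atTop_mul_const hpos).congr' ?_
    filter_upwards [eventually_ge_atTop 0] with N hN
    rw [norm_smul, norm_neg, Real.norm_of_nonneg (by positivity), id]
    ring
  have hchar (N : ℝ) (y : V) :
      Real.fourierChar (-((-(N / (2 * Real.pi))) • ℓ) y) • (f y : ℂ)
        = Complex.exp ((N * ℓ y : ℝ) * Complex.I) * f y := by
    rw [Circle.smul_def, Real.fourierChar_apply, smul_eq_mul, smul_apply]
    congr 4
    simp only [smul_eq_mul]
    field
  have hexp := (tendsto_integral_exp_smul_cocompact (fun y => (f y : ℂ)) μ).comp hfreq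
  refine ((Complex.continuous_re.tendsto 0).comp hexp).congr fun N => ?_
  simp only [Function.comp_apply, hchar]
  have hint : Integrable (fun y => Complex.exp ((N * ℓ y : ℝ) * Complex.I) * f y) μ :=
    hf.ofReal.bdd_mul (c := 1) (by fun_prop)
      (.of_forall fun y => (Complex.norm_exp_ofReal_mul_I _).le)
  rw [← RCLike.re_eq_complex_re, ← integral_re hint]
  refine integral_congr_ae (.of_forall fun y => ?_)
  dsimp only
  rw [RCLike.re_eq_complex_re, Complex.re_mul_ofReal, Complex.exp_ofReal_mul_I_re]

theorem tendsto_integral_cos_sq_mul (hℓ : ℓ ≠ 0) {f : V → ℝ} (hf : Integrable f μ) :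
    Tendsto (fun N : ℝ => ∫ y, Real.cos (N * ℓ y) ^ 2 * f y ∂μ) atTop
      (𝓝 ((∫ y, f y ∂μ) / 2)) := by
  have hdouble : Tendsto (fun N : ℝ => ∫ y, Real.cos (2 * N * ℓ y) * f y ∂μ) atTop (𝓝 0) :=
    (tendsto_integral_cos_mul hℓ hf).comp (tendsto_id.const_mul_atTop two_pos)
  have hlim := (hdouble.const_add (∫ y, f y ∂μ)).div_const 2
  rw [add_zero] at hlim
  refine hlim.congr fun N => ?_
  have hint : Integrable (fun y => Real.cos (2 * N * ℓ y) * f y) μ :=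
    hf.bdd_mul (c := 1) (by fun_prop) (.of_forall fun y => Real.abs_cos_le_one _)
  rw [← integral_add hf hint, ← integral_div]
  refine integral_congr_ae (.of_forall fun y => ?_)
  dsimp only
  rw [Real.cos_sq, mul_assoc]
  ring

end RiemannLebesgue

end Oscillation

section OscillatingField

theorem tendsto_integral_zero_of_norm_le_mul {V E ι : Type*} [MeasurableSpace V] {μ : Measure V}
    [NormedAddCommGroup E] {l : Filter ι} {K : Set V} (hK : μ K < ⊤) {r : ι → V → E}
    (hr : TendstoUniformly r 0 l) {F : ι → V → ℝ} (hFK : ∀ i, ∀ y ∉ K, F i y = 0) {C : ℝ}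
    (hFr : ∀ᶠ i in l, ∀ y ∈ K, ‖F i y‖ ≤ C * ‖r i y‖) :
    Tendsto (fun i => ∫ y, F i y ∂μ) l (𝓝 0) := by
  refine Metric.tendsto_nhds.2 fun ε hε => ?_
  have hpos : 0 < |C| * μ.real K + 1 := by positivity
  filter_upwards [hFr, Metric.tendstoUniformly_iff.1 hr (ε / (|C| * μ.real K + 1))
    (by positivity)] with i hi hri
  have hsmall : ∀ y ∈ K, ‖F i y‖ ≤ |C| * (ε / (|C| * μ.real K + 1)) := fun y hy =>
    (hi y hy).trans (mul_le_mul (le_abs_self C)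
      (by simpa only [Pi.zero_apply, dist_zero_left] using (hri y).le)
      (norm_nonneg _) (abs_nonneg C))
  rw [← setIntegral_eq_integral_of_forall_compl_eq_zero (hFK i), dist_zero_right]
  refine (norm_setIntegral_le_of_norm_le_const hK hsmall).trans_lt ?_
  rw [mul_div_assoc', div_mul_eq_mul_div, div_lt_iff₀ hpos]
  linarith

variable {V E : Type*} [NormedAddCommGroup V] [NormedSpace ℝ V] [FiniteDimensional ℝ V]
  [MeasurableSpace V] [BorelSpace V] {μ : Measure V} [μ.IsAddHaarMeasure]
  [NormedAddCommGroup E] [InnerProductSpace ℝ E] {ℓ : V →L[ℝ] ℝ} {χ : V → ℝ} {η : E}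
  {d : ℝ → V → E}

theorem tendsto_integral_inner_of_oscillating (hℓ : ℓ ≠ 0) (hχ : Continuous χ)
    (hχc : HasCompactSupport χ) (hd : ∀ N, Continuous (d N))
    (hdχ : ∀ N, ∀ y ∉ tsupport χ, d N y = 0)
    (hlim : TendstoUniformly (fun N y => d N y - (χ y * Real.cos (N * ℓ y)) • η) 0 atTop)
    {g : V → E} (hg : Continuous g) :
    Tendsto (fun N => ∫ y, ⟪d N y, g y⟫ ∂μ) atTop (𝓝 0) := by
  obtain ⟨C, hC⟩ := hχc.exists_bound_of_continuousOn hg.continuousOn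
  have hmain : Integrable (fun y => χ y * ⟪η, g y⟫) μ :=
    (hχ.mul (continuous_const.inner hg)).integrable_of_hasCompactSupport hχc.mul_right
  have hosc (N : ℝ) : Integrable (fun y => Real.cos (N * ℓ y) * (χ y * ⟪η, g y⟫)) μ :=
    hmain.bdd_mul (c := 1) (by fun_prop) (.of_forall fun y => Real.abs_cos_le_one _)
  have hint (N : ℝ) : Integrable (fun y => ⟪d N y, g y⟫) μ :=
    ((hd N).inner hg).integrable_of_hasCompactSupport
      (.intro hχc fun y hy => by rw [hdχ N y hy, inner_zero_left])
  have herr : Tendsto (fun N => ∫ y, (⟪d N y, g y⟫ - Real.cos (N * ℓ y) * (χ y * ⟪η, g y⟫)) ∂μ)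
      atTop (𝓝 0) := by
    refine tendsto_integral_zero_of_norm_le_mul (C := C) hχc.measure_lt_top hlim
      (fun N y hy => by simp [hdχ N y hy, image_eq_zero_of_notMem_tsupport hy])
      (.of_forall fun N y hy => ?_)
    have : ⟪d N y, g y⟫ - Real.cos (N * ℓ y) * (χ y * ⟪η, g y⟫)
        = ⟪d N y - (χ y * Real.cos (N * ℓ y)) • η, g y⟫ := by
      rw [inner_sub_left, real_inner_smul_left]
      ring
    rw [this, mul_comm C]
    exact (norm_inner_le_norm _ _).trans (mul_le_mul_of_nonneg_left (hC y hy) (norm_nonneg _))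
  simpa only [integral_sub (hint _) (hosc _), sub_add_cancel, add_zero] using
    herr.add (tendsto_integral_cos_mul hℓ hmain)

theorem tendsto_integral_norm_sq_of_oscillating (hℓ : ℓ ≠ 0) (hχ : Continuous χ)
    (hχc : HasCompactSupport χ) (hη : ‖η‖ = 1) (hd : ∀ N, Continuous (d N))
    (hdχ : ∀ N, ∀ y ∉ tsupport χ, d N y = 0)
    (hlim : TendstoUniformly (fun N y => d N y - (χ y * Real.cos (N * ℓ y)) • η) 0 atTop) :
    Tendsto (fun N => ∫ y, ‖d N y‖ ^ 2 ∂μ) atTop (𝓝 ((∫ y, χ y ^ 2 ∂μ) / 2)) := by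
  obtain ⟨C, hC⟩ := hχc.exists_bound_of_continuous hχ
  have integrable_of {f : V → ℝ} (hf : Continuous f) (hfχ : ∀ y ∉ tsupport χ, f y = 0) :
      Integrable f μ :=
    hf.integrable_of_hasCompactSupport (.intro hχc hfχ)
  have hmain : Integrable (fun y => χ y ^ 2) μ := integrable_of (hχ.pow 2) fun y hy => by
    simp [image_eq_zero_of_notMem_tsupport hy]
  have hosc (N : ℝ) : Integrable (fun y => Real.cos (N * ℓ y) ^ 2 * χ y ^ 2) μ :=
    integrable_of (by fun_prop) fun y hy => by simp [image_eq_zero_of_notMem_tsupport hy]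
  have hint (N : ℝ) : Integrable (fun y => ‖d N y‖ ^ 2) μ :=
    integrable_of ((hd N).norm.pow 2) fun y hy => by simp [hdχ N y hy]
  have herr : Tendsto (fun N => ∫ y, (‖d N y‖ ^ 2 - Real.cos (N * ℓ y) ^ 2 * χ y ^ 2) ∂μ)
      atTop (𝓝 0) := by
    refine tendsto_integral_zero_of_norm_le_mul (C := 2 * C + 1) hχc.measure_lt_top hlim
      (fun N y hy => by simp [hdχ N y hy, image_eq_zero_of_notMem_tsupport hy]) ?_
    filter_upwards [Metric.tendstoUniformly_iff.1 hlim 1 one_pos] with N hN y _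
    have hr : ‖d N y - (χ y * Real.cos (N * ℓ y)) • η‖ ≤ 1 := by
      simpa only [Pi.zero_apply, dist_zero_left] using (hN y).le
    have hcos : ‖(χ y * Real.cos (N * ℓ y)) • η‖ ≤ C := by
      rw [norm_smul, hη, mul_one, norm_mul]
      exact (mul_le_of_le_one_right (norm_nonneg _) (Real.abs_cos_le_one _)).trans (hC y)
    have hsq : Real.cos (N * ℓ y) ^ 2 * χ y ^ 2 = ‖(χ y * Real.cos (N * ℓ y)) • η‖ ^ 2 := by
      rw [norm_smul, hη, mul_one, Real.norm_eq_abs, sq_abs]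
      ring
    have hsum : ‖d N y‖ + ‖(χ y * Real.cos (N * ℓ y)) • η‖ ≤ 2 * C + 1 := by
      linarith [norm_le_norm_add_norm_sub' (d N y) ((χ y * Real.cos (N * ℓ y)) • η)]
    rw [hsq, sq_sub_sq, norm_mul, Real.norm_of_nonneg (by positivity)]
    exact mul_le_mul hsum (abs_norm_sub_norm_le _ _) (norm_nonneg _)
      (by linarith [norm_nonneg ((χ y * Real.cos (N * ℓ y)) • η)])
  simpa only [integral_sub (hint _) (hosc _), sub_add_cancel, zero_add] using
    herr.add (tendsto_integral_cos_sq_mul hℓ hmain)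

end OscillatingField

section BoundedLimits

variable {V E S : Type*} [TopologicalSpace V] [MeasurableSpace V] [OpensMeasurableSpace V]
  [NormedAddCommGroup E] [NormedAddCommGroup S]
  {μ : Measure V} [IsFiniteMeasureOnCompacts μ]
  {A : V → E} {P : E → S → ℝ}

theorem integrable_of_hasCompactSupport_left (hA : Continuous A) (hAc : HasCompactSupport A)
    (hP : Continuous P.uncurry) (hP0 : ∀ s, P 0 s = 0) {z : V → S} (hz : Continuous z) :
    Integrable (fun y => P (A y) (z y)) μ := by
  refine (hP.comp (hA.prodMk hz)).integrable_of_hasCompactSupport (hAc.mono' fun y hy => ?_)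
  contrapose! hy
  simp [image_eq_zero_of_notMem_tsupport hy, hP0]

theorem tendsto_integral_of_bounded_of_tendsto [ProperSpace S]
    (hA : Continuous A) (hAc : HasCompactSupport A) (hP : Continuous P.uncurry)
    (hP0 : ∀ s, P 0 s = 0) {z : ℕ → V → S} {z' : V → S} {C : ℝ}
    (hz : ∀ k, Continuous (z k))
    (hzC : ∀ k y, ‖z k y‖ ≤ C) (hlim : ∀ᵐ y ∂μ, Tendsto (z · y) atTop (𝓝 (z' y))) :
    Tendsto (fun k => ∫ y, P (A y) (z k y) ∂μ) atTop (𝓝 (∫ y, P (A y) (z' y) ∂μ)) := by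
  obtain ⟨M, hM⟩ : ∃ M, ∀ p ∈ range A ×ˢ Metric.closedBall (0 : S) C, ‖P.uncurry p‖ ≤ M :=
    ((hAc.isCompact_range hA).prod (isCompact_closedBall 0 C)).exists_bound_of_continuousOn
      hP.continuousOn
  have hint : Integrable ((tsupport A).indicator fun _ => M) μ :=
    (integrable_indicator_iff (isClosed_tsupport A).measurableSet).2
      (integrableOn_const hAc.measure_lt_top.ne)
  refine tendsto_integral_of_dominated_convergence _
    (fun k => (hP.comp (hA.prodMk (hz k))).aestronglyMeasurable) hint
    (fun k => .of_forall fun y => ?_) ?_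
  · by_cases hy : y ∈ tsupport A
    · rw [indicator_of_mem hy]
      exact hM (A y, z k y) ⟨mem_range_self y, by simpa using hzC k y⟩
    · simp [indicator_of_notMem hy, image_eq_zero_of_notMem_tsupport hy, hP0]
  · filter_upwards [hlim] with y hy
    exact (hP.tendsto (A y, z' y)).comp (tendsto_const_nhds.prodMk_nhds hy)

end BoundedLimits

section LinearEuler

variable {n : ℕ}

/-- The state space of the linear system `∂ₜ v + div u + ∇ q = 0`, `div v = 0` that the Euler
equations become when `v ⊗ v` is replaced by an independent unknown: a state is
`(velocity v, stress u, pressure q)`. -/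
abbrev State (n : ℕ) : Type :=
  EuclideanSpace ℝ (Fin n) × Matrix (Fin n) (Fin n) ℝ × ℝ

/-- The integrand of the weak formulation of `∂ₜ v + div u + ∇ q = 0` at a point where the test
field has derivative `A`. -/
noncomputable def momentumForm (A : SpaceTime n →L[ℝ] EuclideanSpace ℝ (Fin n)) :
    State n →ₗ[ℝ] ℝ where
  toFun z := (∑ i, z.1 i * A (0, 1) i)
    + (∑ i, ∑ j, z.2.1 i j * A (EuclideanSpace.single j 1, 0) i)
    + z.2.2 * ∑ i, A (EuclideanSpace.single i 1, 0) i
  map_add' z z' := by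
    simp only [Prod.fst_add, Prod.snd_add, PiLp.add_apply, Matrix.add_apply, add_mul,
      Finset.sum_add_distrib]
    ring
  map_smul' c z := by
    simp only [Prod.smul_fst, Prod.smul_snd, PiLp.smul_apply, Matrix.smul_apply, smul_eq_mul,
      mul_assoc, ← Finset.mul_sum, RingHom.id_apply]
    ring

theorem momentumForm_apply (A : SpaceTime n →L[ℝ] EuclideanSpace ℝ (Fin n)) (z : State n) :
    momentumForm A z = (∑ i, z.1 i * A (0, 1) i)
      + (∑ i, ∑ j, z.2.1 i j * A (EuclideanSpace.single j 1, 0) i)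
      + z.2.2 * ∑ i, A (EuclideanSpace.single i 1, 0) i :=
  rfl

theorem continuous_momentumForm :
    Continuous (Function.uncurry fun (A : SpaceTime n →L[ℝ] EuclideanSpace ℝ (Fin n))
      (z : State n) => momentumForm A z) := by
  simp only [Function.uncurry_def, momentumForm_apply]
  fun_prop

theorem momentumForm_zero_left (z : State n) :
    momentumForm (0 : SpaceTime n →L[ℝ] EuclideanSpace ℝ (Fin n)) z = 0 := by
  simp [momentumForm_apply]

theorem momentumForm_add_smul_one (A : SpaceTime n →L[ℝ] EuclideanSpace ℝ (Fin n))
    (v : EuclideanSpace ℝ (Fin n)) (u : Matrix (Fin n) (Fin n) ℝ) (a q : ℝ) :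
    momentumForm A (v, u + a • 1, q) = momentumForm A (v, u, q + a) := by
  simp only [momentumForm_apply, Matrix.add_apply, Matrix.smul_apply, Matrix.one_apply, add_mul,
    Finset.sum_add_distrib, smul_eq_mul, mul_ite, mul_one, mul_zero, ite_mul, zero_mul,
    Finset.sum_ite_eq, Finset.mem_univ, if_true, ← Finset.mul_sum]
  ring

theorem continuous_apply_fst_zero :
    Continuous (Function.uncurry fun (A : SpaceTime n →L[ℝ] ℝ) (z : State n) => A (z.1, 0)) := by
  simp only [Function.uncurry_def]
  fun_prop

/-- `z = (v, u, q)` solves `∂ₜ v + div u + ∇ q = 0` and `div v = 0` weakly. No integrability is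
required, so the two identities only carry information for locally integrable fields. -/
structure IsLinearEulerSolution (z : SpaceTime n → State n) : Prop where
  momentum : ∀ φ : SpaceTime n → EuclideanSpace ℝ (Fin n), ContDiff ℝ ∞ φ → HasCompactSupport φ →
    ∫ y, momentumForm (fderiv ℝ φ y) (z y) = 0
  incompressible : ∀ ψ : SpaceTime n → ℝ, ContDiff ℝ ∞ ψ → HasCompactSupport ψ →
    ∫ y, fderiv ℝ ψ y ((z y).1, 0) = 0

theorem isLinearEulerSolution_of_tendsto {z : ℕ → SpaceTime n → State n}
    {z' : SpaceTime n → State n} {C : ℝ} (hsol : ∀ k, IsLinearEulerSolution (z k))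
    (hz : ∀ k, Continuous (z k)) (hzC : ∀ k y, ‖z k y‖ ≤ C)
    (hlim : ∀ᵐ y, Tendsto (z · y) atTop (𝓝 (z' y))) : IsLinearEulerSolution z' where
  momentum φ hφ hφc := by
    refine tendsto_nhds_unique (tendsto_integral_of_bounded_of_tendsto
      (hφ.continuous_fderiv (by simp)) (hφc.fderiv ℝ) continuous_momentumForm
      momentumForm_zero_left hz hzC hlim) ?_
    simp only [(hsol _).momentum φ hφ hφc, tendsto_const_nhds]
  incompressible ψ hψ hψc := by
    refine tendsto_nhds_unique (tendsto_integral_of_bounded_of_tendsto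
      (hψ.continuous_fderiv (by simp)) (hψc.fderiv ℝ) continuous_apply_fst_zero
      (fun _ => rfl) hz hzC hlim) ?_
    simp only [(hsol _).incompressible ψ hψ hψc, tendsto_const_nhds]

/-- A continuous, compactly supported solution of the linear system with symmetric and trace-free
stress. -/
structure IsRegularSolution (z : SpaceTime n → State n) : Prop
    extends IsLinearEulerSolution z where
  continuous : Continuous z
  hasCompactSupport : HasCompactSupport z
  isSymm : ∀ y, (z y).2.1.IsSymm
  trace_eq_zero : ∀ y, (z y).2.1.trace = 0

theorem isRegularSolution_zero : IsRegularSolution (0 : SpaceTime n → State n) where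
  momentum φ _ _ := by simp
  incompressible ψ _ _ := by simp [Prod.mk_zero_zero]
  continuous := continuous_const
  hasCompactSupport := .zero
  isSymm _ := Matrix.isSymm_zero
  trace_eq_zero _ := Matrix.trace_zero _ _

namespace IsRegularSolution

variable {z z' : SpaceTime n → State n}

theorem integrable_momentumForm (hz : IsRegularSolution z)
    {φ : SpaceTime n → EuclideanSpace ℝ (Fin n)} (hφ : ContDiff ℝ ∞ φ)
    (hφc : HasCompactSupport φ) : Integrable fun y => momentumForm (fderiv ℝ φ y) (z y) :=
  integrable_of_hasCompactSupport_left (hφ.continuous_fderiv (by simp)) (hφc.fderiv ℝ)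
    continuous_momentumForm momentumForm_zero_left hz.continuous

theorem integrable_divergence (hz : IsRegularSolution z) {ψ : SpaceTime n → ℝ}
    (hψ : ContDiff ℝ ∞ ψ) (hψc : HasCompactSupport ψ) :
    Integrable fun y => fderiv ℝ ψ y ((z y).1, 0) :=
  integrable_of_hasCompactSupport_left (hψ.continuous_fderiv (by simp)) (hψc.fderiv ℝ)
    continuous_apply_fst_zero (fun _ => rfl) hz.continuous

theorem add (hz : IsRegularSolution z) (hz' : IsRegularSolution z') :
    IsRegularSolution (z + z') where
  momentum φ hφ hφc := by
    simp only [Pi.add_apply, map_add]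
    rw [integral_add (hz.integrable_momentumForm hφ hφc) (hz'.integrable_momentumForm hφ hφc),
      hz.momentum φ hφ hφc, hz'.momentum φ hφ hφc, add_zero]
  incompressible ψ hψ hψc := by
    have split (y : SpaceTime n) : fderiv ℝ ψ y (((z + z') y).1, 0)
        = fderiv ℝ ψ y ((z y).1, 0) + fderiv ℝ ψ y ((z' y).1, 0) := by
      rw [← map_add, Prod.mk_add_mk, add_zero, Pi.add_apply, Prod.fst_add]
    simp only [split]
    rw [integral_add (hz.integrable_divergence hψ hψc) (hz'.integrable_divergence hψ hψc),
      hz.incompressible ψ hψ hψc, hz'.incompressible ψ hψ hψc, add_zero]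
  continuous := hz.continuous.add hz'.continuous
  hasCompactSupport := hz.hasCompactSupport.add hz'.hasCompactSupport
  isSymm y := (hz.isSymm y).add (hz'.isSymm y)
  trace_eq_zero y := by
    simp [Matrix.trace_add, hz.trace_eq_zero y, hz'.trace_eq_zero y]

theorem sum {ι : Type*} {s : Finset ι} {w : ι → SpaceTime n → State n}
    (hw : ∀ i ∈ s, IsRegularSolution (w i)) : IsRegularSolution (∑ i ∈ s, w i) :=
  Finset.sum_induction _ IsRegularSolution (fun _ _ => add) isRegularSolution_zero hw

end IsRegularSolution

end LinearEuler

section Waves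

variable {n : ℕ}

/-- The symmetric tensor `a ⊗ b + b ⊗ a`. -/
def symProd (a b : EuclideanSpace ℝ (Fin n)) : Matrix (Fin n) (Fin n) ℝ :=
  Matrix.vecMulVec a.ofLp b.ofLp + Matrix.vecMulVec b.ofLp a.ofLp

theorem symProd_apply (a b : EuclideanSpace ℝ (Fin n)) (i j : Fin n) :
    symProd a b i j = a i * b j + b i * a j :=
  rfl

theorem isSymm_symProd (a b : EuclideanSpace ℝ (Fin n)) : (symProd a b).IsSymm :=
  Matrix.IsSymm.ext fun i j => by simp only [symProd_apply]; ring

theorem trace_symProd (a b : EuclideanSpace ℝ (Fin n)) : (symProd a b).trace = 2 * ⟪a, b⟫ := by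
  rw [symProd, Matrix.trace_add, Matrix.trace_vecMulVec, Matrix.trace_vecMulVec,
    EuclideanSpace.inner_eq_star_dotProduct, star_trivial, dotProduct_comm b.ofLp a.ofLp]
  ring

/-- The state with velocity `v` and total momentum flux `a ⊗ b + b ⊗ a`, split into trace-free
stress and pressure. -/
noncomputable def fluxState (v a b : EuclideanSpace ℝ (Fin n)) : State n :=
  (v, symProd a b + -(2 * ⟪a, b⟫ / n) • 1, 2 * ⟪a, b⟫ / n)

theorem map_prod_zero_eq_sum {F : Type*} [NormedAddCommGroup F] [NormedSpace ℝ F]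
    (A : SpaceTime n →L[ℝ] F) (b : EuclideanSpace ℝ (Fin n)) :
    A (b, 0) = ∑ j, b j • A (EuclideanSpace.single j 1, 0) := by
  have h := congrArg (A ∘L .inl ℝ _ ℝ) ((EuclideanSpace.basisFun (Fin n) ℝ).sum_repr b)
  simpa using h.symm

theorem momentumForm_fluxState (A : SpaceTime n →L[ℝ] EuclideanSpace ℝ (Fin n))
    (v a b : EuclideanSpace ℝ (Fin n)) :
    momentumForm A (fluxState v a b) = ⟪v, A (0, 1)⟫ + ⟪a, A (b, 0)⟫ + ⟪b, A (a, 0)⟫ := by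
  rw [fluxState, momentumForm_add_smul_one, add_neg_cancel, momentumForm_apply, zero_mul,
    add_zero, add_assoc, map_prod_zero_eq_sum A a, map_prod_zero_eq_sum A b]
  simp only [PiLp.inner_apply, RCLike.inner_apply, conj_trivial, symProd_apply, PiLp.smul_apply,
    WithLp.ofLp_sum, Finset.sum_apply, smul_eq_mul, Finset.sum_mul, ← Finset.sum_add_distrib]
  refine Finset.sum_congr rfl fun i _ => ?_
  rw [mul_comm (v i)]
  congr 1
  exact Finset.sum_congr rfl fun j _ => by ring

theorem trace_fluxState [NeZero n] (v a b : EuclideanSpace ℝ (Fin n)) :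
    (fluxState v a b).2.1.trace = 0 := by
  have hn : (n : ℝ) ≠ 0 := NeZero.ne _
  simp only [fluxState, Matrix.trace_add, trace_symProd, Matrix.trace_smul, Matrix.trace_one,
    Fintype.card_fin, smul_eq_mul]
  field

theorem isSymm_fluxState (v a b : EuclideanSpace ℝ (Fin n)) : (fluxState v a b).2.1.IsSymm :=
  (isSymm_symProd a b).add (Matrix.isSymm_one.smul _)

/-- The solution of the linear system generated by a scalar potential `Φ`; its coefficients are
the second derivatives of `Φ` in the directions `ζ`, `η` and the space-time direction `(w, 1)`. -/
noncomputable def waveField (w η ζ : EuclideanSpace ℝ (Fin n)) (Φ : SpaceTime n → ℝ)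
    (y : SpaceTime n) : State n :=
  dirDeriv (ζ, 0) (dirDeriv (ζ, 0) Φ) y • fluxState η w η
    - dirDeriv (ζ, 0) (dirDeriv (η, 0) Φ) y • fluxState ζ w ζ
    - dirDeriv (w, 1) (dirDeriv (ζ, 0) Φ) y • fluxState 0 ζ η
    + dirDeriv (w, 1) (dirDeriv (η, 0) Φ) y • fluxState 0 ζ ζ

theorem dirDeriv_inner {V : Type*} [NormedAddCommGroup V] [NormedSpace ℝ V]
    {E : Type*} [NormedAddCommGroup E] [InnerProductSpace ℝ E] {φ : V → E}
    (hφ : ContDiff ℝ ∞ φ) (p : E) (a y : V) :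
    dirDeriv a (fun y => ⟪p, φ y⟫) y = ⟪p, fderiv ℝ φ y a⟫ := by
  have h : HasFDerivAt (fun y => ⟪p, φ y⟫) _ y :=
    (innerSL ℝ p).hasFDerivAt.comp y (hφ.differentiable (by simp) y).hasFDerivAt
  rw [dirDeriv, h.fderiv]
  rfl

instance isAddHaarMeasure_spaceTime : (volume : Measure (SpaceTime n)).IsAddHaarMeasure :=
  inferInstanceAs (((volume : Measure (EuclideanSpace ℝ (Fin n))).prod
    (volume : Measure ℝ)).IsAddHaarMeasure)

variable {Φ : SpaceTime n → ℝ}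

theorem momentumForm_waveField (hΦ : ContDiff ℝ ∞ Φ)
    {φ : SpaceTime n → EuclideanSpace ℝ (Fin n)} (hφ : ContDiff ℝ ∞ φ)
    (w η ζ : EuclideanSpace ℝ (Fin n)) :
    (fun y => momentumForm (fderiv ℝ φ y) (waveField w η ζ Φ y)) =
      jacobian (dirDeriv (ζ, 0) Φ) (fun y => ⟪η, φ y⟫) (ζ, 0) (w, 1)
      + jacobian (dirDeriv (ζ, 0) Φ) (fun y => ⟪w, φ y⟫) (ζ, 0) (η, 0)
      + jacobian (dirDeriv (η, 0) Φ) (fun y => ⟪ζ, φ y⟫) (w, 1) (ζ, 0)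
      + jacobian (dirDeriv (w, 1) Φ) (fun y => ⟪ζ, φ y⟫) (η, 0) (ζ, 0) := by
  funext y
  have hw : fderiv ℝ φ y (w, 1) = fderiv ℝ φ y (w, 0) + fderiv ℝ φ y (0, 1) := by
    rw [← map_add, Prod.mk_add_mk, add_zero, zero_add]
  simp only [waveField, map_add, map_sub, map_smul, momentumForm_fluxState, smul_eq_mul,
    Pi.add_apply, jacobian, dirDeriv_inner hφ, hw, inner_add_right, inner_zero_left]
  rw [dirDeriv_comm hΦ (η, 0) (ζ, 0), dirDeriv_comm hΦ (η, 0) (w, 1),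
    dirDeriv_comm hΦ (ζ, 0) (w, 1)]
  ring

theorem divergence_waveField (hΦ : ContDiff ℝ ∞ Φ) (ψ : SpaceTime n → ℝ)
    (w η ζ : EuclideanSpace ℝ (Fin n)) (y : SpaceTime n) :
    fderiv ℝ ψ y ((waveField w η ζ Φ y).1, 0) =
      jacobian (dirDeriv (ζ, 0) Φ) ψ (ζ, 0) (η, 0) y := by
  have hv : ((waveField w η ζ Φ y).1, (0 : ℝ)) =
      dirDeriv (ζ, 0) (dirDeriv (ζ, 0) Φ) y • (η, (0 : ℝ))
        - dirDeriv (ζ, 0) (dirDeriv (η, 0) Φ) y • (ζ, (0 : ℝ)) := by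
    simp [waveField, fluxState]
  rw [hv, map_sub, map_smul, map_smul, dirDeriv_comm hΦ (ζ, 0) (η, 0)]
  rfl

theorem waveField_eq_zero_of_notMem_tsupport (w η ζ : EuclideanSpace ℝ (Fin n)) {y : SpaceTime n}
    (hy : y ∉ tsupport Φ) : waveField w η ζ Φ y = 0 := by
  have vanish (a b : SpaceTime n) : dirDeriv a (dirDeriv b Φ) y = 0 :=
    image_eq_zero_of_notMem_tsupport fun h =>
      hy (tsupport_dirDeriv_subset _ _ (tsupport_dirDeriv_subset _ _ h))
  simp [waveField, vanish]

theorem isRegularSolution_waveField [NeZero n] (hΦ : ContDiff ℝ ∞ Φ) (hΦc : HasCompactSupport Φ)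
    (w η ζ : EuclideanSpace ℝ (Fin n)) : IsRegularSolution (waveField w η ζ Φ) where
  momentum φ hφ hφc := by
    have hp (p : EuclideanSpace ℝ (Fin n)) : ContDiff ℝ ∞ fun y => ⟪p, φ y⟫ :=
      contDiff_const.inner ℝ hφ
    have hpc (p : EuclideanSpace ℝ (Fin n)) : HasCompactSupport fun y => ⟪p, φ y⟫ :=
      hφc.comp_left (g := fun x => ⟪p, x⟫) (inner_zero_right p)
    have hint (a b c : SpaceTime n) (p : EuclideanSpace ℝ (Fin n)) :
        Integrable (jacobian (dirDeriv b Φ) (fun y => ⟪p, φ y⟫) a c) :=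
      integrable_jacobian (contDiff_dirDeriv hΦ b) (hp p) (hpc p) a c
    have hzero (a b c : SpaceTime n) (p : EuclideanSpace ℝ (Fin n)) :
        ∫ y, jacobian (dirDeriv b Φ) (fun y => ⟪p, φ y⟫) a c y = 0 :=
      integral_jacobian (contDiff_dirDeriv hΦ b) (hp p) (hpc p) a c
    rw [momentumForm_waveField hΦ hφ,
      integral_add' (((hint _ _ _ _).add (hint _ _ _ _)).add (hint _ _ _ _)) (hint _ _ _ _),
      integral_add' ((hint _ _ _ _).add (hint _ _ _ _)) (hint _ _ _ _),
      integral_add' (hint _ _ _ _) (hint _ _ _ _)]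
    simp only [hzero, add_zero]
  incompressible ψ hψ hψc := by
    simp only [divergence_waveField hΦ]
    exact integral_jacobian (contDiff_dirDeriv hΦ _) hψ hψc _ _
  continuous := by
    have hcont (a b : SpaceTime n) : Continuous (dirDeriv a (dirDeriv b Φ)) :=
      (contDiff_dirDeriv (contDiff_dirDeriv hΦ b) a).continuous
    unfold waveField
    fun_prop
  hasCompactSupport :=
    .intro hΦc fun _ hy => waveField_eq_zero_of_notMem_tsupport w η ζ hy
  isSymm y := by
    refine (((?_ : Matrix.IsSymm _).sub ?_).sub ?_).add ?_ <;>
      exact (isSymm_fluxState _ _ _).smul _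
  trace_eq_zero y := by
    simp [waveField, Matrix.trace_add, Matrix.trace_sub, Matrix.trace_smul, trace_fluxState]

end Waves

section LocalizedWave

variable {n : ℕ}

/-- The direction in state space in which a plane wave with velocity `η` oscillates around a state
of velocity `v₀`. The stress is chosen so that moving in this direction changes `v ⊗ v - u` only by
multiples of `η ⊗ η`. -/
noncomputable def waveDirection (v₀ η : EuclideanSpace ℝ (Fin n)) : State n :=
  (η, symProd (v₀ - ⟪v₀, η⟫ • η) η, 0)

/-- The phase `ζ · (x - v₀ t)` of a plane wave transported by the velocity `v₀`. -/
noncomputable def wavePhase (v₀ ζ : EuclideanSpace ℝ (Fin n)) : SpaceTime n →L[ℝ] ℝ :=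
  (innerSL ℝ ζ).comp (ContinuousLinearMap.fst ℝ _ _)
    - ⟪v₀, ζ⟫ • ContinuousLinearMap.snd ℝ _ _

theorem wavePhase_apply (v₀ ζ x : EuclideanSpace ℝ (Fin n)) (t : ℝ) :
    wavePhase v₀ ζ (x, t) = ⟪ζ, x⟫ - ⟪v₀, ζ⟫ * t :=
  rfl

/-- The exact solution of the linear system that approximates, at high frequency `N`, the plane
wave of envelope `χ` in the direction `waveDirection v₀ η`. -/
noncomputable def localizedWave (v₀ η ζ : EuclideanSpace ℝ (Fin n)) (χ : SpaceTime n → ℝ)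
    (N : ℝ) : SpaceTime n → State n :=
  waveField (v₀ - ⟪v₀, η⟫ • η) η ζ (wavePotential χ (wavePhase v₀ ζ) N)

variable {v₀ η ζ : EuclideanSpace ℝ (Fin n)} {χ : SpaceTime n → ℝ}

theorem wavePhase_ne_zero (hζ : ‖ζ‖ = 1) : wavePhase v₀ ζ ≠ 0 := fun h => by
  simpa [wavePhase_apply, hζ] using DFunLike.congr_fun h (ζ, 0)

theorem localizedWave_eq_zero {y : SpaceTime n} (hy : y ∉ tsupport χ) (N : ℝ) :
    localizedWave v₀ η ζ χ N y = 0 :=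
  waveField_eq_zero_of_notMem_tsupport _ _ _ fun h => hy (tsupport_wavePotential_subset _ _ _ h)

theorem isRegularSolution_localizedWave [NeZero n] (hχ : ContDiff ℝ ∞ χ)
    (hχc : HasCompactSupport χ) (N : ℝ) : IsRegularSolution (localizedWave v₀ η ζ χ N) :=
  isRegularSolution_waveField (contDiff_wavePotential hχ _ N)
    (hχc.of_isClosed_subset (isClosed_tsupport _) (tsupport_wavePotential_subset _ _ N)) _ _ _

theorem tendstoUniformly_localizedWave (hχ : ContDiff ℝ ∞ χ) (hχc : HasCompactSupport χ)
    (hη : ‖η‖ = 1) (hζ : ‖ζ‖ = 1) (hηζ : ⟪η, ζ⟫ = 0) :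
    TendstoUniformly (fun (N : ℝ) y => localizedWave v₀ η ζ χ N y
      - (χ y * Real.cos (N * wavePhase v₀ ζ y)) • waveDirection v₀ η) 0 atTop := by
  set w := v₀ - ⟪v₀, η⟫ • η with hw
  have hwη : ⟪w, η⟫ = 0 := by
    rw [hw, inner_sub_left, real_inner_smul_left, real_inner_self_eq_norm_sq, hη]
    ring
  have phase_ζ : wavePhase v₀ ζ (ζ, 0) = 1 := by simp [wavePhase_apply, hζ]
  have phase_η : wavePhase v₀ ζ (η, 0) = 0 := by simp [wavePhase_apply, real_inner_comm, hηζ]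
  have phase_w : wavePhase v₀ ζ (w, 1) = 0 := by
    rw [wavePhase_apply, hw, inner_sub_right, real_inner_smul_right, real_inner_comm v₀ ζ,
      real_inner_comm η ζ, hηζ]
    ring
  have direction : waveDirection v₀ η = fluxState η w η := by
    simp [waveDirection, fluxState, ← hw, hwη]
  have term (a b : SpaceTime n) (s : State n) := (ContinuousLinearMap.toSpanSingleton ℝ
    s).uniformContinuous.comp_tendstoUniformly
      (tendstoUniformly_dirDeriv_dirDeriv_wavePotential hχ hχc (wavePhase v₀ ζ) a b)
  have h := (((term (ζ, 0) (ζ, 0) (fluxState η w η)).sub (term (ζ, 0) (η, 0) (fluxState ζ w ζ))).sub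
    (term (w, 1) (ζ, 0) (fluxState 0 ζ η))).add (term (w, 1) (η, 0) (fluxState 0 ζ ζ))
  convert h using 1
  · funext N y
    simp only [localizedWave, waveField, direction, ← hw, Pi.add_apply, Pi.sub_apply,
      Function.comp_apply, ContinuousLinearMap.toSpanSingleton_apply, phase_ζ, phase_η, phase_w,
      mul_one, mul_zero, sub_zero, sub_smul]
    abel
  · funext y
    simp

theorem tendstoUniformly_velocity_localizedWave (hχ : ContDiff ℝ ∞ χ) (hχc : HasCompactSupport χ)
    (hη : ‖η‖ = 1) (hζ : ‖ζ‖ = 1) (hηζ : ⟪η, ζ⟫ = 0) :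
    TendstoUniformly (fun (N : ℝ) y => (localizedWave v₀ η ζ χ N y).1
      - (χ y * Real.cos (N * wavePhase v₀ ζ y)) • η) 0 atTop :=
  uniformContinuous_fst.comp_tendstoUniformly (tendstoUniformly_localizedWave hχ hχc hη hζ hηζ)

theorem tendsto_integral_inner_localizedWave [NeZero n] (hχ : ContDiff ℝ ∞ χ)
    (hχc : HasCompactSupport χ) (hη : ‖η‖ = 1) (hζ : ‖ζ‖ = 1) (hηζ : ⟪η, ζ⟫ = 0)
    {g : SpaceTime n → EuclideanSpace ℝ (Fin n)} (hg : Continuous g) :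
    Tendsto (fun N => ∫ y, ⟪(localizedWave v₀ η ζ χ N y).1, g y⟫) atTop (𝓝 0) :=
  tendsto_integral_inner_of_oscillating (wavePhase_ne_zero hζ) hχ.continuous hχc
    (fun N => continuous_fst.comp (isRegularSolution_localizedWave hχ hχc N).continuous)
    (fun N _ hy => congrArg Prod.fst (localizedWave_eq_zero hy N))
    (tendstoUniformly_velocity_localizedWave hχ hχc hη hζ hηζ) hg

theorem tendsto_integral_norm_sq_localizedWave [NeZero n] (hχ : ContDiff ℝ ∞ χ)
    (hχc : HasCompactSupport χ) (hη : ‖η‖ = 1) (hζ : ‖ζ‖ = 1) (hηζ : ⟪η, ζ⟫ = 0) :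
    Tendsto (fun N => ∫ y, ‖(localizedWave v₀ η ζ χ N y).1‖ ^ 2) atTop
      (𝓝 ((∫ y, χ y ^ 2) / 2)) :=
  tendsto_integral_norm_sq_of_oscillating (wavePhase_ne_zero hζ) hχ.continuous hχc hη
    (fun N => continuous_fst.comp (isRegularSolution_localizedWave hχ hχc N).continuous)
    (fun N _ hy => congrArg Prod.fst (localizedWave_eq_zero hy N))
    (tendstoUniformly_velocity_localizedWave hχ hχc hη hζ hηζ)

theorem exists_isRegularSolution_near_wave [NeZero n] (v₀ : EuclideanSpace ℝ (Fin n))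
    (hχ : ContDiff ℝ ∞ χ) (hχc : HasCompactSupport χ) (hη : ‖η‖ = 1) (hζ : ‖ζ‖ = 1)
    (hηζ : ⟪η, ζ⟫ = 0) {T : Finset (SpaceTime n → EuclideanSpace ℝ (Fin n))}
    (hT : ∀ g ∈ T, Continuous g) {ε G : ℝ} (hε : 0 < ε) (hG : G < (∫ y, χ y ^ 2) / 2) :
    ∃ w : SpaceTime n → State n, IsRegularSolution w ∧ (∀ y ∉ tsupport χ, w y = 0) ∧
      (∀ y, ∃ τ, |τ| ≤ |χ y| ∧ ‖w y - τ • waveDirection v₀ η‖ < ε) ∧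
      (∀ g ∈ T, |∫ y, ⟪(w y).1, g y⟫| < ε) ∧ G < ∫ y, ‖(w y).1‖ ^ 2 := by
  have hclose := Metric.tendstoUniformly_iff.1
    (tendstoUniformly_localizedWave (v₀ := v₀) hχ hχc hη hζ hηζ) ε hε
  have horth : ∀ᶠ N in atTop, ∀ g ∈ T, |∫ y, ⟪(localizedWave v₀ η ζ χ N y).1, g y⟫| < ε :=
    T.eventually_all.2 fun g hg =>
      (tendsto_integral_inner_localizedWave hχ hχc hη hζ hηζ (hT g hg)).abs.eventually_lt_const
        (by rwa [abs_zero])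
  have hgain := (tendsto_integral_norm_sq_localizedWave (v₀ := v₀) hχ hχc hη hζ
    hηζ).eventually_const_lt hG
  obtain ⟨N, hNclose, hNorth, hNgain⟩ := (hclose.and (horth.and hgain)).exists
  refine ⟨localizedWave v₀ η ζ χ N, isRegularSolution_localizedWave hχ hχc N,
    fun y hy => localizedWave_eq_zero hy N,
    fun y => ⟨χ y * Real.cos (N * wavePhase v₀ ζ y), ?_, ?_⟩, hNorth, hNgain⟩
  · rw [abs_mul]
    exact mul_le_of_le_one_right (abs_nonneg _) (Real.abs_cos_le_one _)
  · simpa only [Pi.zero_apply, dist_zero_left] using hNclose y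

end LocalizedWave

section PositiveDefinite

variable {ι : Type*} [Fintype ι] {A : Matrix ι ι ℝ}

theorem abs_apply_le_trace_of_posSemidef (hA : A.PosSemidef) (i j : ι) :
    |A i j| ≤ A.trace := by
  classical
  have hsymm : A j i = A i j := hA.isHermitian.apply i j
  have hdiag (k : ι) : A k k ≤ A.trace :=
    Finset.single_le_sum (f := fun k => A k k) (fun _ _ => hA.diag_nonneg) (Finset.mem_univ k)
  have hquad (s : ℝ) : 0 ≤ A i i + 2 * s * A i j + s ^ 2 * A j j := by
    have h := hA.dotProduct_mulVec_nonneg (Pi.single i 1 + s • Pi.single j 1)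
    simp only [star_trivial, Matrix.mulVec_add, Matrix.mulVec_smul, add_dotProduct,
      dotProduct_add, smul_dotProduct, dotProduct_smul, single_one_dotProduct,
      Matrix.mulVec_single_one, Matrix.col_apply, smul_eq_mul, hsymm] at h
    linarith
  rw [abs_le]
  constructor <;> linarith [hquad 1, hquad (-1), hdiag i, hdiag j]

theorem posDef_sub_smul_vecMulVec (hA : A.PosDef) {η : ι → ℝ} {a μ : ℝ} (hη : η ⬝ᵥ η = 1)
    (heig : A *ᵥ η = a • η) (hμ : μ < a) : (A - μ • Matrix.vecMulVec η η).PosDef := by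
  have hsymm : Aᵀ = A := by
    simpa only [Matrix.conjTranspose_eq_transpose_of_trivial] using hA.isHermitian.eq
  refine .of_dotProduct_mulVec_pos (hA.isHermitian.sub ?_) fun x hx => ?_
  · ext i j
    simp [Matrix.vecMulVec_apply, mul_comm]
  set t := η ⬝ᵥ x with ht
  set y := x - t • η with hy
  have hleft : η ⬝ᵥ A *ᵥ x = a * t := by
    rw [Matrix.dotProduct_mulVec, ← Matrix.mulVec_transpose, hsymm, heig, smul_dotProduct,
      smul_eq_mul]
  have hsplit : star x ⬝ᵥ (A - μ • Matrix.vecMulVec η η) *ᵥ x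
      = (a - μ) * t ^ 2 + star y ⬝ᵥ A *ᵥ y := by
    simp only [hy, star_trivial, Matrix.sub_mulVec, Matrix.smul_mulVec, Matrix.vecMulVec_mulVec,
      Matrix.mulVec_sub, Matrix.mulVec_smul, heig, dotProduct_sub, sub_dotProduct,
      dotProduct_smul, smul_dotProduct, hη, hleft, dotProduct_comm x η, ← ht, smul_eq_mul,
      MulOpposite.smul_eq_mul_unop, MulOpposite.unop_op]
    ring
  rw [hsplit]
  obtain h0 | h0 := eq_or_ne t 0
  · have : y = x := by simp [hy, h0]
    simpa [this, h0] using hA.dotProduct_mulVec_pos hx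
  · exact add_pos_of_pos_of_nonneg (mul_pos (sub_pos.2 hμ) (by positivity))
      (hA.posSemidef.dotProduct_mulVec_nonneg y)

theorem exists_forall_posDef_sub_smul_vecMulVec [Nonempty ι] (hA : A.PosDef) :
    ∃ η : EuclideanSpace ℝ ι, ‖η‖ = 1 ∧ ∀ μ < A.trace / Fintype.card ι,
      (A - μ • Matrix.vecMulVec η.ofLp η.ofLp).PosDef := by
  classical
  have hH := hA.isHermitian
  have hsum : ∑ _i : ι, A.trace / Fintype.card ι ≤ ∑ i, hH.eigenvalues i := by
    rw [Finset.sum_const, Finset.card_univ, nsmul_eq_mul, mul_div_cancel₀ _ (by positivity)]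
    exact hH.trace_eq_sum_eigenvalues.le
  obtain ⟨k, -, hk⟩ := Finset.exists_le_of_sum_le Finset.univ_nonempty hsum
  have hnorm : ‖hH.eigenvectorBasis k‖ = 1 := hH.eigenvectorBasis.orthonormal.1 k
  refine ⟨hH.eigenvectorBasis k, hnorm, fun μ hμ => posDef_sub_smul_vecMulVec hA ?_
    (hH.mulVec_eigenvectorBasis k) (hμ.trans_le hk)⟩
  have h := EuclideanSpace.inner_eq_star_dotProduct (hH.eigenvectorBasis k)
    (hH.eigenvectorBasis k)
  rwa [star_trivial, real_inner_self_eq_norm_sq, hnorm, one_pow, eq_comm] at h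

end PositiveDefinite

theorem exists_norm_eq_one_inner_eq_zero {E : Type*} [NormedAddCommGroup E]
    [InnerProductSpace ℝ E] [FiniteDimensional ℝ E] (hE : 1 < Module.finrank ℝ E) (η : E) :
    ∃ ζ : E, ‖ζ‖ = 1 ∧ ⟪η, ζ⟫ = 0 := by
  have hne : (ℝ ∙ η)ᗮ ≠ ⊥ := fun h => by
    have hspan : Module.finrank ℝ (ℝ ∙ η) ≤ 1 := by
      simpa using finrank_span_le_card (R := ℝ) ({η} : Set E)
    have hsum := Submodule.finrank_add_finrank_orthogonal (ℝ ∙ η)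
    rw [h, finrank_bot] at hsum
    omega
  have := (Submodule.nontrivial_iff_ne_bot).2 hne
  obtain ⟨ζ, hζ⟩ := exists_norm_eq (ℝ ∙ η)ᗮ zero_le_one
  exact ⟨ζ, hζ, Submodule.mem_orthogonal_singleton_iff_inner_right.1 ζ.2⟩

section StrictState

variable {n : ℕ}

/-- The defect `(e / n) Id + u - v ⊗ v` of a state `(v, u, q)` relative to the energy density `e`:
a state with vanishing defect is one of the Euler equations with `|v|² = e`. -/
noncomputable def energyDefect (e : ℝ) (z : State n) : Matrix (Fin n) (Fin n) ℝ :=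
  (e / n) • 1 + z.2.1 - Matrix.vecMulVec z.1.ofLp z.1.ofLp

/-- A state is strict if the quadratic form of its energy defect is positive definite. Symmetry of
the stress is not included, which makes this an open condition on the whole state space. -/
def IsStrictState (e : ℝ) (z : State n) : Prop :=
  ∀ x : Fin n → ℝ, x ≠ 0 → 0 < x ⬝ᵥ energyDefect e z *ᵥ x

variable {e : ℝ} {z : State n}

theorem isOpen_setOf_isStrictState (e : ℝ) : IsOpen {z : State n | IsStrictState e z} := by
  have hcont : Continuous fun p : State n × (Fin n → ℝ) =>
      p.2 ⬝ᵥ energyDefect e p.1 *ᵥ p.2 := by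
    unfold energyDefect
    fun_prop
  have hsphere (z : State n) : IsStrictState e z ↔
      ∀ x ∈ Metric.sphere (0 : Fin n → ℝ) 1, 0 < x ⬝ᵥ energyDefect e z *ᵥ x := by
    refine ⟨fun h x hx => h x (ne_zero_of_mem_unit_sphere ⟨x, hx⟩), fun h x hx => ?_⟩
    have hnorm : 0 < ‖x‖ := norm_pos_iff.2 hx
    have hunit := h (‖x‖⁻¹ • x) (by simp [norm_smul, hnorm.ne'])
    simp only [Matrix.mulVec_smul, dotProduct_smul, smul_dotProduct, smul_eq_mul] at hunit
    exact pos_of_mul_pos_right (pos_of_mul_pos_right hunit (by positivity)) (by positivity)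
  refine isOpen_iff_mem_nhds.2 fun z hz => ?_
  have hnear : ∀ᶠ z' in 𝓝 z, ∀ x ∈ Metric.sphere (0 : Fin n → ℝ) 1,
      0 < x ⬝ᵥ energyDefect e z' *ᵥ x :=
    (isCompact_sphere _ _).eventually_forall_of_forall_eventually fun x hx =>
      (hcont.tendsto (z, x)).eventually (lt_mem_nhds ((hsphere z).1 hz x hx))
  exact hnear.mono fun z' => (hsphere z').2

theorem trace_energyDefect [NeZero n] (e : ℝ) (hz : z.2.1.trace = 0) :
    (energyDefect e z).trace = e - ‖z.1‖ ^ 2 := by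
  have hn : (n : ℝ) ≠ 0 := NeZero.ne _
  rw [energyDefect, Matrix.trace_sub, Matrix.trace_add, Matrix.trace_smul, Matrix.trace_one, hz,
    Matrix.trace_vecMulVec, EuclideanSpace.real_norm_sq_eq, Fintype.card_fin, smul_eq_mul,
    div_mul_cancel₀ _ hn, add_zero]
  simp only [dotProduct, sq]

theorem energyDefect_add_smul_waveDirection (e : ℝ) (z : State n)
    (η : EuclideanSpace ℝ (Fin n)) (τ : ℝ) :
    energyDefect e (z + τ • waveDirection z.1 η) = energyDefect e z
      - (2 * τ * ⟪z.1, η⟫ + τ ^ 2) • Matrix.vecMulVec η.ofLp η.ofLp := by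
  ext i j
  simp [energyDefect, waveDirection, symProd_apply, Matrix.vecMulVec_apply]
  ring

namespace IsStrictState

theorem posDef (h : IsStrictState e z) (hz : z.2.1.IsSymm) : (energyDefect e z).PosDef := by
  refine .of_dotProduct_mulVec_pos (Matrix.IsHermitian.ext fun i j => ?_) fun x hx => ?_
  · simp [energyDefect, Matrix.vecMulVec_apply, hz.apply i j, Matrix.one_apply, eq_comm (a := i),
      mul_comm]
  · simpa only [star_trivial] using h x hx

variable [NeZero n]

theorem norm_sq_lt (h : IsStrictState e z) (hz : z.2.1.IsSymm) (hz0 : z.2.1.trace = 0) :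
    ‖z.1‖ ^ 2 < e := by
  rw [← sub_pos, ← trace_energyDefect e hz0]
  exact (h.posDef hz).trace_pos

theorem norm_velocity_le (h : IsStrictState e z) (hz : z.2.1.IsSymm) (hz0 : z.2.1.trace = 0) :
    ‖z.1‖ ≤ √e :=
  Real.le_sqrt_of_sq_le (h.norm_sq_lt hz hz0).le

theorem norm_stress_le (h : IsStrictState e z) (hz : z.2.1.IsSymm) (hz0 : z.2.1.trace = 0) :
    ‖z.2.1‖ ≤ 2 * e := by
  have he : 0 < e := (sq_nonneg _).trans_lt (h.norm_sq_lt hz hz0)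
  refine (Matrix.norm_le_iff (by positivity)).2 fun i j => ?_
  have hdefect : |energyDefect e z i j| ≤ e - ‖z.1‖ ^ 2 := by
    rw [← trace_energyDefect e hz0]
    exact abs_apply_le_trace_of_posSemidef (h.posDef hz).posSemidef i j
  have hprod : |z.1 i * z.1 j| ≤ ‖z.1‖ ^ 2 := by
    rw [abs_mul, sq]
    exact mul_le_mul (PiLp.norm_apply_le z.1 i) (PiLp.norm_apply_le z.1 j) (abs_nonneg _)
      (norm_nonneg _)
  have hone : |(e / n) * (1 : Matrix (Fin n) (Fin n) ℝ) i j| ≤ e := by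
    have hle : e / n ≤ e := div_le_self he.le (Nat.one_le_cast.2 NeZero.one_le)
    rw [abs_le, Matrix.one_apply]
    split_ifs <;> constructor <;> linarith [div_nonneg he.le (Nat.cast_nonneg (α := ℝ) n)]
  have hentry : energyDefect e z i j
      = (e / n) * (1 : Matrix (Fin n) (Fin n) ℝ) i j + z.2.1 i j - z.1 i * z.1 j := rfl
  rw [Real.norm_eq_abs]
  rw [hentry] at hdefect
  rw [abs_le] at *
  constructor <;> linarith [hdefect.1, hdefect.2, hprod.1, hprod.2, hone.1, hone.2]

end IsStrictState

/-- Half the length of a segment in a wave direction along which a strict state stays strict. -/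
noncomputable def waveAmplitude (e : ℝ) (z : State n) : ℝ :=
  (e - ‖z.1‖ ^ 2) / (4 * n * √e)

theorem waveAmplitude_pos [NeZero n] (h : ‖z.1‖ ^ 2 < e) : 0 < waveAmplitude e z := by
  have he : 0 < e := (sq_nonneg _).trans_lt h
  have hn : (0 : ℝ) < n := Nat.cast_pos.2 (NeZero.pos n)
  exact div_pos (sub_pos.2 h) (by positivity)

theorem two_mul_mul_add_sq_lt_of_abs_le_waveAmplitude [NeZero n] (h : ‖z.1‖ ^ 2 < e) {τ b : ℝ}
    (hτ : |τ| ≤ waveAmplitude e z) (hb : |b| ≤ √e) :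
    2 * τ * b + τ ^ 2 < (e - ‖z.1‖ ^ 2) / n := by
  have hn : (1 : ℝ) ≤ n := Nat.one_le_cast.2 NeZero.one_le
  have he : 0 < e := (sq_nonneg _).trans_lt h
  have hlt : 0 < e - ‖z.1‖ ^ 2 := sub_pos.2 h
  set r := √e with hr
  set a := waveAmplitude e z with ha
  have hr0 : 0 < r := Real.sqrt_pos.2 he
  have ha0 : 0 < a := waveAmplitude_pos h
  have hproduct : 4 * (a * r) = (e - ‖z.1‖ ^ 2) / n := by
    rw [ha, waveAmplitude, ← hr]
    field_simp
  have har : a ≤ r := by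
    refine le_of_mul_le_mul_right ?_ hr0
    calc a * r ≤ 4 * (a * r) := le_mul_of_one_le_left (by positivity) (by norm_num)
      _ ≤ e - ‖z.1‖ ^ 2 := hproduct.trans_le (div_le_self hlt.le hn)
      _ ≤ r * r := by rw [← sq, hr, Real.sq_sqrt he.le]; exact sub_le_self _ (sq_nonneg _)
  calc 2 * τ * b + τ ^ 2 ≤ 2 * (|τ| * |b|) + |τ| * |τ| := by
        rw [abs_mul_abs_self, mul_assoc, ← abs_mul, ← sq]
        gcongr
        exact le_abs_self _
    _ ≤ 2 * (a * r) + a * r := by gcongr; exact hτ.trans har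
    _ < (e - ‖z.1‖ ^ 2) / n := by linarith [mul_pos ha0 hr0]

theorem IsStrictState.exists_segment (hn : 2 ≤ n) (h : IsStrictState e z) (hz : z.2.1.IsSymm)
    (hz0 : z.2.1.trace = 0) :
    ∃ η ζ : EuclideanSpace ℝ (Fin n), ‖η‖ = 1 ∧ ‖ζ‖ = 1 ∧ ⟪η, ζ⟫ = 0 ∧
      ∀ τ, |τ| ≤ waveAmplitude e z → IsStrictState e (z + τ • waveDirection z.1 η) := by
  have : NeZero n := ⟨by omega⟩
  obtain ⟨η, hη, hpos⟩ := exists_forall_posDef_sub_smul_vecMulVec (h.posDef hz)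
  obtain ⟨ζ, hζ, hηζ⟩ := exists_norm_eq_one_inner_eq_zero
    (by rwa [finrank_euclideanSpace_fin]) η
  refine ⟨η, ζ, hη, hζ, hηζ, fun τ hτ x hx => ?_⟩
  have hinner : |⟪z.1, η⟫| ≤ √e := (abs_real_inner_le_norm z.1 η).trans (by
    rw [hη, mul_one]
    exact h.norm_velocity_le hz hz0)
  rw [energyDefect_add_smul_waveDirection]
  refine (hpos _ ?_).dotProduct_mulVec_pos hx
  rw [trace_energyDefect e hz0, Fintype.card_fin]
  exact two_mul_mul_add_sq_lt_of_abs_le_waveAmplitude (h.norm_sq_lt hz hz0) hτ hinner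

end StrictState

section BumpFunction

variable {V : Type*} [NormedAddCommGroup V] [NormedSpace ℝ V] [FiniteDimensional ℝ V]
  [MeasurableSpace V] [BorelSpace V] {μ : Measure V} [μ.IsAddHaarMeasure] {c : V}

theorem measureReal_closedBall_rIn_le_integral_sq (χ : ContDiffBump c) :
    μ.real (Metric.closedBall c χ.rIn) ≤ ∫ y, χ y ^ 2 ∂μ := by
  have hint : Integrable (fun y => χ y ^ 2) μ :=
    (χ.continuous.pow 2).integrable_of_hasCompactSupport
      (by simpa only [sq] using χ.hasCompactSupport.mul_left (f := χ))
  calc μ.real (Metric.closedBall c χ.rIn) = ∫ _ in Metric.closedBall c χ.rIn, (1 : ℝ) ∂μ := by simp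
    _ = ∫ y in Metric.closedBall c χ.rIn, χ y ^ 2 ∂μ :=
        setIntegral_congr_fun Metric.isClosed_closedBall.measurableSet fun y hy => by
          simp [χ.one_of_mem_closedBall hy]
    _ ≤ ∫ y, χ y ^ 2 ∂μ := setIntegral_le_integral hint (.of_forall fun _ => sq_nonneg _)

theorem measureReal_closedBall_half {ρ : ℝ} (hρ : 0 ≤ ρ) :
    μ.real (Metric.closedBall c (ρ / 2))
      = (1 / 2) ^ Module.finrank ℝ V * μ.real (Metric.closedBall c ρ) := by
  rw [Measure.addHaar_real_closedBall' _ _ (by positivity),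
    Measure.addHaar_real_closedBall' _ _ hρ, div_pow, one_div_pow]
  ring

end BumpFunction

theorem exists_forall_add_smul_add_mem {S : Type*} [NormedAddCommGroup S] [NormedSpace ℝ S]
    {U : Set S} (hU : IsOpen U) {s₀ d : S} {a : ℝ} (hseg : ∀ τ, |τ| ≤ a → s₀ + τ • d ∈ U) :
    ∃ ε > 0, ∀ s, ‖s - s₀‖ < ε → ∀ τ, |τ| ≤ a → ∀ w, ‖w - τ • d‖ < ε → s + w ∈ U := by
  have hK : IsCompact ((fun τ : ℝ => s₀ + τ • d) '' Icc (-a) a) :=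
    isCompact_Icc.image (by fun_prop)
  obtain ⟨r, hr, hrU⟩ := hK.exists_thickening_subset_open hU
    (image_subset_iff.2 fun τ hτ => hseg τ (abs_le.2 hτ))
  refine ⟨r / 2, half_pos hr, fun s hs τ hτ w hw => hrU (Metric.mem_thickening_iff.2
    ⟨_, mem_image_of_mem _ (abs_le.1 hτ), ?_⟩)⟩
  rw [dist_eq_norm, add_sub_add_comm]
  linarith [norm_add_le (s - s₀) (w - τ • d)]

section Perturbation

variable {n : ℕ} {e : ℝ} {z : SpaceTime n → State n} {y₀ : SpaceTime n}

/-- On the set `B` the field `z` can be perturbed through strict states, with a kinetic energy of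
the perturbation at least `G`, while its pressure and its correlations with any finitely many given
velocity fields are arbitrarily small. -/
def IsPerturbable (e : ℝ) (z : SpaceTime n → State n) (B : Set (SpaceTime n)) (G : ℝ) : Prop :=
  ∀ T : Finset (SpaceTime n → EuclideanSpace ℝ (Fin n)), (∀ g ∈ T, Continuous g) → ∀ ε > 0,
    ∃ w : SpaceTime n → State n, IsRegularSolution w ∧ (∀ y ∉ B, w y = 0) ∧
      (∀ y ∈ B, IsStrictState e (z y + w y)) ∧ (∀ y, |(w y).2.2| ≤ ε) ∧
      (∀ g ∈ T, |∫ y, ⟪(w y).1, g y⟫| ≤ ε) ∧ G ≤ ∫ y, ‖(w y).1‖ ^ 2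

/-- The proportion of the squared energy defect that a single perturbation turns into energy. The
factor `(1 / 2) ^ (n + 1)` is the volume ratio of space-time balls of radii `ρ / 2` and `ρ`. -/
noncomputable def gainConstant (n : ℕ) (e : ℝ) : ℝ :=
  (1 / 2) ^ (n + 1) / (64 * n ^ 2 * e)

theorem gainConstant_pos [NeZero n] (he : 0 < e) : 0 < gainConstant n e := by
  have : (0 : ℝ) < n := Nat.cast_pos.2 (NeZero.pos n)
  unfold gainConstant
  positivity

theorem gainConstant_mul_sq (he : 0 ≤ e) (s : State n) :
    gainConstant n e * (e - ‖s.1‖ ^ 2) ^ 2 = (1 / 2) ^ (n + 1) * waveAmplitude e s ^ 2 / 4 := by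
  rw [gainConstant, waveAmplitude, div_pow _ _ 2, mul_pow, mul_pow, Real.sq_sqrt he]
  ring

theorem gain_lt_integral_sq [NeZero n] {s : State n} (hs : ‖s.1‖ ^ 2 < e) (χ : ContDiffBump y₀)
    {ρ : ℝ} (hρ : 0 < ρ) (hχ : χ.rIn = ρ / 2) :
    gainConstant n e * (e - ‖s.1‖ ^ 2) ^ 2 * volume.real (Metric.closedBall y₀ ρ)
      < (∫ y, (waveAmplitude e s * χ y) ^ 2) / 2 := by
  have hfinrank : Module.finrank ℝ (SpaceTime n) = n + 1 := by simp [SpaceTime]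
  have hamp := waveAmplitude_pos hs
  have hvol : 0 < volume.real (Metric.closedBall y₀ ρ) :=
    ENNReal.toReal_pos (Metric.measure_closedBall_pos _ _ hρ).ne' measure_closedBall_lt_top.ne
  have hhalf := measureReal_closedBall_half (μ := volume) (c := y₀) hρ.le
  rw [hfinrank, ← hχ] at hhalf
  simp only [mul_pow, integral_const_mul]
  calc gainConstant n e * (e - ‖s.1‖ ^ 2) ^ 2 * volume.real (Metric.closedBall y₀ ρ)
      = waveAmplitude e s ^ 2 * volume.real (Metric.closedBall y₀ χ.rIn) / 4 := by
        rw [gainConstant_mul_sq ((sq_nonneg _).trans hs.le), hhalf]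
        ring
    _ < waveAmplitude e s ^ 2 * volume.real (Metric.closedBall y₀ χ.rIn) / 2 := by
        refine div_lt_div_of_pos_left ?_ two_pos (by norm_num)
        rw [hhalf]
        positivity
    _ ≤ (waveAmplitude e s ^ 2 * ∫ y, χ y ^ 2) / 2 := by
        gcongr
        exact measureReal_closedBall_rIn_le_integral_sq χ

theorem eventually_isPerturbable_closedBall (hn : 2 ≤ n) (hz : Continuous z)
    (hsymm : (z y₀).2.1.IsSymm) (htrace : (z y₀).2.1.trace = 0) (h : IsStrictState e (z y₀)) :
    ∀ᶠ ρ in 𝓝[>] 0, IsPerturbable e z (Metric.closedBall y₀ ρ)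
      (gainConstant n e * (e - ‖(z y₀).1‖ ^ 2) ^ 2 * volume.real (Metric.closedBall y₀ ρ)) := by
  have : NeZero n := ⟨by omega⟩
  have hlt := h.norm_sq_lt hsymm htrace
  obtain ⟨η, ζ, hη, hζ, hηζ, hseg⟩ := h.exists_segment hn hsymm htrace
  obtain ⟨ε₀, hε₀, hstay⟩ := exists_forall_add_smul_add_mem (isOpen_setOf_isStrictState e) hseg
  obtain ⟨δ, hδ, hδz⟩ := Metric.continuous_iff.1 hz y₀ ε₀ hε₀
  filter_upwards [Ioo_mem_nhdsGT hδ] with ρ ⟨hρ, hρδ⟩ T hT ε hε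
  let χ : ContDiffBump y₀ := ⟨ρ / 2, ρ, half_pos hρ, half_lt_self hρ⟩
  set a := waveAmplitude e (z y₀)
  have ha0 : 0 < a := waveAmplitude_pos hlt
  have hψ : ContDiff ℝ ∞ fun y => a * χ y := contDiff_const.mul χ.contDiff
  have hψc : HasCompactSupport fun y => a * χ y := χ.hasCompactSupport.mul_left
  have hψB : tsupport (fun y => a * χ y) ⊆ Metric.closedBall y₀ ρ :=
    (tsupport_mul_subset_right (f := fun _ => a)).trans χ.tsupport_eq.subset
  obtain ⟨w, hw, hw0, hwave, horth, hgain⟩ := exists_isRegularSolution_near_wave (z y₀).1 hψ hψc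
    hη hζ hηζ hT (lt_min hε₀ hε) (gain_lt_integral_sq hlt χ hρ rfl)
  refine ⟨w, hw, fun y hy => hw0 y fun h => hy (hψB h), fun y hy => ?_, fun y => ?_,
    fun g hg => (horth g hg).le.trans (min_le_right _ _), hgain.le⟩
  all_goals obtain ⟨τ, hτ, hwτ⟩ := hwave y
  · refine hstay _ ?_ τ (hτ.trans ?_) _ (hwτ.trans_le (min_le_left _ _))
    · simpa only [dist_eq_norm] using hδz y (lt_of_le_of_lt hy hρδ)
    · rw [abs_mul, abs_of_pos ha0, abs_of_nonneg χ.nonneg]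
      exact mul_le_of_le_one_right ha0.le χ.le_one
  · have hp := ((norm_snd_le _).trans (norm_snd_le _)).trans
      (hwτ.le.trans (min_le_right _ _))
    simpa [waveDirection] using hp

end Perturbation

theorem sum_eq_zero_or_exists_sum_eq {ι X S : Type*} [AddCommMonoid S] {s : Finset ι}
    {B : ι → Set X} (hB : (s : Set ι).PairwiseDisjoint B) {w : ι → X → S}
    (hw : ∀ i ∈ s, ∀ y ∉ B i, w i y = 0) (y : X) :
    (∀ i ∈ s, w i y = 0) ∨
      ∃ j ∈ s, y ∈ B j ∧ (∀ i ∈ s, i ≠ j → w i y = 0) ∧ (∑ i ∈ s, w i) y = w j y := by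
  by_cases hy : ∃ j ∈ s, y ∈ B j
  · obtain ⟨j, hj, hyj⟩ := hy
    have hzero (i : ι) (hi : i ∈ s) (hij : i ≠ j) : w i y = 0 :=
      hw i hi y (disjoint_left.1 (hB hj hi hij.symm) hyj)
    refine .inr ⟨j, hj, hyj, hzero, ?_⟩
    rw [Finset.sum_apply]
    exact Finset.sum_eq_single_of_mem j hj hzero
  · push Not at hy
    exact .inl fun i hi => hw i hi y (hy i hi)

section DisjointBalls

variable {V : Type*} [NormedAddCommGroup V] [NormedSpace ℝ V] [FiniteDimensional ℝ V]
  [MeasurableSpace V] [BorelSpace V] {μ : Measure V} {Q : Set V} {F : V → ℝ}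

theorem exists_finset_disjoint_closedBall_lt_sum_integral [SFinite μ] (hF : IntegrableOn F Q μ)
    {good : V → Set ℝ}
    (hgood : ∀ y ∈ Q, ∀ δ > 0, (good y ∩ Ioo 0 δ).Nonempty)
    (hgoodQ : ∀ y ∈ Q, ∀ ρ ∈ good y, Metric.closedBall y ρ ⊆ Q) {m : ℝ}
    (hm : m < ∫ y in Q, F y ∂μ) :
    ∃ (s : Finset V) (r : V → ℝ), (∀ y ∈ s, y ∈ Q ∧ r y ∈ good y) ∧
      (s : Set V).PairwiseDisjoint (fun y => Metric.closedBall y (r y)) ∧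
      m < ∑ y ∈ s, ∫ x in Metric.closedBall y (r y), F x ∂μ := by
  obtain ⟨t, r, htc, htQ, htr, hcov, hdisj⟩ :=
    Besicovitch.exists_disjoint_closedBall_covering_ae μ good Q hgood 1 fun _ _ => one_pos
  have hsub (i : t) : Metric.closedBall i.1 (r i) ⊆ Q :=
    hgoodQ i (htQ i.2) _ (htr i i.2).1
  have : Countable t := htc.to_subtype
  have hae : Q =ᵐ[μ] ⋃ i : t, Metric.closedBall i.1 (r i) := by
    rw [biUnion_eq_iUnion] at hcov
    exact (ae_le_set.2 hcov).antisymm (.of_forall (iUnion_subset hsub))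
  have hsum : HasSum (fun i : t => ∫ x in Metric.closedBall i.1 (r i), F x ∂μ)
      (∫ x in ⋃ i : t, Metric.closedBall i.1 (r i), F x ∂μ) :=
    hasSum_integral_iUnion (fun i => Metric.isClosed_closedBall.measurableSet)
      (fun i j hij => hdisj i.2 j.2 fun h => hij (Subtype.ext h))
      (hF.mono_set (iUnion_subset hsub))
  rw [← setIntegral_congr_set hae] at hsum
  obtain ⟨s, hs⟩ := (hsum.eventually (lt_mem_nhds hm)).exists
  have hst : ∀ y ∈ s.map (.subtype _), y ∈ t := fun y hy => by
    obtain ⟨i, -, rfl⟩ := Finset.mem_map.1 hy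
    exact i.2
  refine ⟨s.map (.subtype _), r, fun y hy => ⟨htQ (hst y hy), (htr y (hst y hy)).1⟩,
    hdisj.subset hst, ?_⟩
  rwa [Finset.sum_map]

theorem exists_finset_disjoint_closedBall_lt_two_mul_sum [IsFiniteMeasureOnCompacts μ]
    (hQ : IsOpen Q) (hF : Continuous F) (hFQ : IntegrableOn F Q μ) (hF0 : ∀ y ∈ Q, 0 < F y)
    {P : V → ℝ → Prop} (hP : ∀ y ∈ Q, ∀ᶠ ρ in 𝓝[>] 0, P y ρ) {m : ℝ}
    (hm : m < ∫ y in Q, F y ∂μ) :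
    ∃ (s : Finset V) (r : V → ℝ), (∀ y ∈ s, Metric.closedBall y (r y) ⊆ Q ∧ P y (r y)) ∧
      (s : Set V).PairwiseDisjoint (fun y => Metric.closedBall y (r y)) ∧
      m < 2 * ∑ y ∈ s, F y * μ.real (Metric.closedBall y (r y)) := by
  let good (y : V) : Set ℝ :=
    {ρ | P y ρ ∧ Metric.closedBall y ρ ⊆ {x | x ∈ Q ∧ F x ≤ 2 * F y}}
  have hgood (y : V) (hy : y ∈ Q) : ∀ᶠ ρ in 𝓝[>] 0, ρ ∈ good y := by
    have hF2 : ∀ᶠ x in 𝓝 y, F x ≤ 2 * F y :=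
      hF.continuousAt.eventually (ge_mem_nhds (by linarith [hF0 y hy]))
    exact (hP y hy).and ((eventually_closedBall_subset
      ((hQ.eventually_mem hy).and hF2)).filter_mono nhdsWithin_le_nhds)
  obtain ⟨s, r, hsr, hdisj, hs⟩ := exists_finset_disjoint_closedBall_lt_sum_integral hFQ
    (fun y hy δ hδ => ((hgood y hy).and (Ioo_mem_nhdsGT hδ)).exists)
    (fun y _ ρ hρ x hx => (hρ.2 hx).1) hm
  refine ⟨s, r, fun y hy => ⟨fun x hx => ((hsr y hy).2.2 hx).1, (hsr y hy).2.1⟩, hdisj, ?_⟩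
  refine hs.trans_le ?_
  rw [Finset.mul_sum]
  refine Finset.sum_le_sum fun y hy => ?_
  have hsub := (hsr y hy).2.2
  have hle := setIntegral_mono_on (hFQ.mono_set fun x hx => (hsub hx).1)
    (integrableOn_const measure_closedBall_lt_top.ne) Metric.isClosed_closedBall.measurableSet
    fun x hx => (hsub hx).2
  rw [setIntegral_const, smul_eq_mul] at hle
  linarith

end DisjointBalls

section Energy

variable {n : ℕ} {z z' : SpaceTime n → State n}

namespace IsRegularSolution

theorem hasCompactSupport_velocity (hz : IsRegularSolution z) :
    HasCompactSupport fun y => (z y).1 :=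
  hz.hasCompactSupport.comp_left (g := Prod.fst) rfl

theorem continuous_velocity (hz : IsRegularSolution z) : Continuous fun y => (z y).1 :=
  hz.continuous.fst

theorem integrable_inner (hz : IsRegularSolution z) {g : SpaceTime n → EuclideanSpace ℝ (Fin n)}
    (hg : Continuous g) : Integrable fun y => ⟪(z y).1, g y⟫ :=
  (hz.continuous_velocity.inner hg).integrable_of_hasCompactSupport
    (hz.hasCompactSupport_velocity.mono' fun y hy => subset_tsupport _ fun h => hy (by simp [h]))

theorem integrable_norm_sq (hz : IsRegularSolution z) : Integrable fun y => ‖(z y).1‖ ^ 2 := by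
  simpa only [real_inner_self_eq_norm_sq] using hz.integrable_inner hz.continuous_velocity

theorem integral_norm_add_sq (hz : IsRegularSolution z) (hz' : IsRegularSolution z') :
    ∫ y, ‖((z + z') y).1‖ ^ 2
      = (∫ y, ‖(z y).1‖ ^ 2) + 2 * (∫ y, ⟪(z' y).1, (z y).1⟫) + ∫ y, ‖(z' y).1‖ ^ 2 := by
  have hinner := (hz'.integrable_inner hz.continuous_velocity).const_mul 2
  simp only [Pi.add_apply, Prod.fst_add, norm_add_sq_real, real_inner_comm (z' _).1]
  rw [integral_add _ hz'.integrable_norm_sq, integral_add hz.integrable_norm_sq hinner,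
    integral_const_mul]
  exact hz.integrable_norm_sq.add hinner

theorem integral_norm_sq_sum {ι : Type*} {s : Finset ι} {B : ι → Set (SpaceTime n)}
    (hdisj : (s : Set ι).PairwiseDisjoint B) {w : ι → SpaceTime n → State n}
    (hw : ∀ i ∈ s, IsRegularSolution (w i)) (hw0 : ∀ i ∈ s, ∀ y ∉ B i, w i y = 0) :
    ∫ y, ‖((∑ i ∈ s, w i) y).1‖ ^ 2 = ∑ i ∈ s, ∫ y, ‖(w i y).1‖ ^ 2 := by
  rw [← integral_finsetSum _ fun i hi => (hw i hi).integrable_norm_sq]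
  congr! 2 with y
  obtain h | ⟨j, hj, -, h0, h⟩ := sum_eq_zero_or_exists_sum_eq hdisj hw0 y
  · rw [Finset.sum_apply, Finset.sum_eq_zero h, Finset.sum_eq_zero fun i hi => by simp [h i hi]]
    simp
  · rw [h]
    exact (Finset.sum_eq_single_of_mem (f := fun i => ‖(w i y).1‖ ^ 2) j hj
      fun i hi hij => by simp [h0 i hi hij]).symm

end IsRegularSolution

end Energy

section Subsolution

variable {n : ℕ} {Q : Set (SpaceTime n)} {e : ℝ} {z : SpaceTime n → State n}

/-- A subsolution of the Euler equations: a regular solution of the linear system that vanishes off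
`Q` and takes values in the strict states at energy level `e`. -/
structure IsSubsolution (Q : Set (SpaceTime n)) (e : ℝ) (z : SpaceTime n → State n) : Prop
    extends IsRegularSolution z where
  eq_zero : ∀ y ∉ Q, z y = 0
  isStrictState : ∀ y, IsStrictState e (z y)

theorem isSubsolution_zero [NeZero n] (Q : Set (SpaceTime n)) (he : 0 < e) :
    IsSubsolution Q e (0 : SpaceTime n → State n) where
  toIsRegularSolution := isRegularSolution_zero
  eq_zero _ _ := rfl
  isStrictState y x hx := by
    have hn : (0 : ℝ) < n := Nat.cast_pos.2 (NeZero.pos n)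
    have hx' : 0 < x ⬝ᵥ x := by simpa using Matrix.dotProduct_star_self_pos_iff.2 hx
    have : energyDefect e ((0 : SpaceTime n → State n) y) = (e / n) • 1 := by
      simp [energyDefect]
    rw [this, Matrix.smul_mulVec, Matrix.one_mulVec, dotProduct_smul, smul_eq_mul]
    positivity

namespace IsSubsolution

theorem exists_add_sum (hz : IsSubsolution Q e z) {ι : Type*} {s : Finset ι}
    {B : ι → Set (SpaceTime n)} {G : ι → ℝ} (hBQ : ∀ i ∈ s, B i ⊆ Q)
    (hdisj : (s : Set ι).PairwiseDisjoint B) (hB : ∀ i ∈ s, IsPerturbable e z (B i) (G i))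
    {T : Finset (SpaceTime n → EuclideanSpace ℝ (Fin n))} (hT : ∀ g ∈ T, Continuous g)
    {ε : ℝ} (hε : 0 < ε) :
    ∃ w : SpaceTime n → State n, IsRegularSolution w ∧ IsSubsolution Q e (z + w) ∧
      (∀ y, |(w y).2.2| ≤ ε) ∧ (∀ g ∈ T, |∫ y, ⟪(w y).1, g y⟫| ≤ s.card * ε) ∧
      ∑ i ∈ s, G i ≤ ∫ y, ‖(w y).1‖ ^ 2 := by
  choose! w hw hw0 hstrict hpressure horth hgain using fun i hi => hB i hi T hT ε hε
  have hW := IsRegularSolution.sum hw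
  have hcases := sum_eq_zero_or_exists_sum_eq hdisj hw0
  have hsum (y : SpaceTime n) (h : ∀ i ∈ s, w i y = 0) : (∑ i ∈ s, w i) y = 0 := by
    rw [Finset.sum_apply, Finset.sum_eq_zero h]
  refine ⟨∑ i ∈ s, w i, hW, ⟨hz.toIsRegularSolution.add hW, fun y hy => ?_, fun y => ?_⟩,
    fun y => ?_, fun g hg => ?_, ?_⟩
  · rw [Pi.add_apply, hz.eq_zero y hy,
      hsum y fun i hi => hw0 i hi y fun h => hy (hBQ i hi h), add_zero]
  · rw [Pi.add_apply]
    obtain h | ⟨j, hj, hyj, -, h⟩ := hcases y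
    · simpa only [hsum y h, add_zero] using hz.isStrictState y
    · simpa only [h] using hstrict j hj y hyj
  · obtain h | ⟨j, hj, -, -, h⟩ := hcases y
    · simpa [hsum y h] using hε.le
    · simpa only [h] using hpressure j hj y
  · have hlin : ∫ y, ⟪((∑ i ∈ s, w i) y).1, g y⟫ = ∑ i ∈ s, ∫ y, ⟪(w i y).1, g y⟫ := by
      rw [← integral_finsetSum _ fun i hi => (hw i hi).integrable_inner (hT g hg)]
      simp only [Finset.sum_apply, Prod.fst_sum, sum_inner]
    rw [hlin, ← nsmul_eq_mul]
    exact (Finset.abs_sum_le_sum_abs _ _).trans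
      (Finset.sum_le_card_nsmul _ _ _ fun i hi => horth i hi g hg)
  · rw [IsRegularSolution.integral_norm_sq_sum hdisj hw hw0]
    exact Finset.sum_le_sum hgain

theorem exists_perturbable_family (hn : 2 ≤ n) (hQo : IsOpen Q) (hQb : Bornology.IsBounded Q)
    (he : 0 < e) (hz : IsSubsolution Q e z) {m : ℝ}
    (hm : m < ∫ y in Q, (e - ‖(z y).1‖ ^ 2) ^ 2) :
    ∃ (s : Finset (SpaceTime n)) (B : SpaceTime n → Set (SpaceTime n)) (G : SpaceTime n → ℝ),
      (∀ i ∈ s, B i ⊆ Q) ∧ (s : Set (SpaceTime n)).PairwiseDisjoint B ∧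
      (∀ i ∈ s, IsPerturbable e z (B i) (G i)) ∧ gainConstant n e / 2 * m ≤ ∑ i ∈ s, G i := by
  have : NeZero n := ⟨by omega⟩
  set F : SpaceTime n → ℝ := fun y => (e - ‖(z y).1‖ ^ 2) ^ 2
  have hFc : Continuous F := by
    have := hz.continuous_velocity
    fun_prop
  have hFpos (y : SpaceTime n) : 0 < F y :=
    pow_pos (sub_pos.2 ((hz.isStrictState y).norm_sq_lt (hz.isSymm y) (hz.trace_eq_zero y))) 2
  have hFQ : IntegrableOn F Q :=
    (hFc.continuousOn.integrableOn_compact hQb.isCompact_closure).mono_set subset_closure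
  obtain ⟨s, r, hsr, hdisj, hs⟩ := exists_finset_disjoint_closedBall_lt_two_mul_sum hQo hFc hFQ
    (fun y _ => hFpos y) (fun y _ => eventually_isPerturbable_closedBall hn hz.continuous
      (hz.isSymm y) (hz.trace_eq_zero y) (hz.isStrictState y)) hm
  refine ⟨s, fun y => Metric.closedBall y (r y), _, fun y hy => (hsr y hy).1, hdisj,
    fun y hy => (hsr y hy).2, ?_⟩
  have hβ := gainConstant_pos (n := n) he
  simp only [mul_assoc (gainConstant n e), ← Finset.mul_sum]
  calc gainConstant n e / 2 * m
      ≤ gainConstant n e / 2 * (2 * ∑ y ∈ s, F y * volume.real (Metric.closedBall y (r y))) := by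
        gcongr
    _ = gainConstant n e * ∑ y ∈ s, F y * volume.real (Metric.closedBall y (r y)) := by ring

theorem exists_energy_gain (hn : 2 ≤ n) (hQo : IsOpen Q) (hQb : Bornology.IsBounded Q)
    (he : 0 < e) (hz : IsSubsolution Q e z)
    {T : Finset (SpaceTime n → EuclideanSpace ℝ (Fin n))} (hT : ∀ g ∈ T, Continuous g)
    {ε : ℝ} (hε : 0 < ε) :
    ∃ z' : SpaceTime n → State n, IsSubsolution Q e z' ∧
      (∀ y, |(z' y).2.2 - (z y).2.2| ≤ ε) ∧ (∀ g ∈ T, |∫ y, ⟪(z' y).1 - (z y).1, g y⟫| ≤ ε) ∧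
      (∫ y, ‖(z y).1‖ ^ 2) + gainConstant n e / 8 * (∫ y in Q, (e - ‖(z y).1‖ ^ 2) ^ 2)
        ≤ ∫ y, ‖(z' y).1‖ ^ 2 := by
  classical
  have : NeZero n := ⟨by omega⟩
  have hβ := gainConstant_pos (n := n) he
  set D := ∫ y in Q, (e - ‖(z y).1‖ ^ 2) ^ 2
  have hD0 : 0 ≤ D := integral_nonneg fun y => sq_nonneg _
  obtain hD | hD := hD0.eq_or_lt
  · exact ⟨z, hz, by simp [hε.le], by simp [hε.le], by simp [← hD]⟩
  obtain ⟨s, B, G, hBQ, hdisj, hB, hG⟩ :=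
    hz.exists_perturbable_family hn hQo hQb he (half_lt_self hD)
  set κ := min ε (gainConstant n e / 8 * D) / (2 * (s.card + 1)) with hκ
  have hκ0 : 0 < κ := by positivity
  have hκs : 2 * (s.card + 1) * κ = min ε (gainConstant n e / 8 * D) :=
    mul_div_cancel₀ _ (by positivity)
  have hκε : 2 * (s.card + 1) * κ ≤ ε := hκs.trans_le (min_le_left _ _)
  have hκD : 2 * (s.card + 1) * κ ≤ gainConstant n e / 8 * D := hκs.trans_le (min_le_right _ _)
  have hsκ : 0 ≤ s.card * κ := by positivity
  obtain ⟨w, hw, hsub, hpressure, horth, hgain⟩ := hz.exists_add_sum hBQ hdisj hB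
    (T := insert (fun y => (z y).1) T) (by simpa using ⟨hz.continuous_velocity, hT⟩) hκ0
  refine ⟨z + w, hsub, fun y => ?_, fun g hg => ?_, ?_⟩
  · simpa using (hpressure y).trans (by linarith)
  · simpa using (horth g (Finset.mem_insert_of_mem hg)).trans (by linarith)
  · have hcross := (abs_le.1 (horth _ (Finset.mem_insert_self _ _))).1
    rw [hz.integral_norm_add_sq hw]
    linarith

end IsSubsolution

end Subsolution

theorem exists_seq_of_forall_finset {α : Type*} (a₀ : α) {R : ℕ → α → α → α → Prop}
    (h : ∀ k a, ∀ T : Finset α, ∃ b, ∀ t ∈ T, R k a b t) :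
    ∃ f : ℕ → α, f 0 = a₀ ∧ ∀ k, ∀ i ≤ k, R k (f k) (f (k + 1)) (f i) := by
  classical
  choose next hnext using h
  let S (k : ℕ) : α × Finset α := Nat.rec (a₀, {a₀})
    (fun k s => (next k s.1 s.2, insert (next k s.1 s.2) s.2)) k
  have hmem (k : ℕ) : (S k).1 ∈ (S k).2 := by
    cases k
    exacts [Finset.mem_singleton_self _, Finset.mem_insert_self _ _]
  have hmono : Monotone fun k => (S k).2 :=
    monotone_nat_of_le_succ fun k => Finset.subset_insert _ _
  exact ⟨fun k => (S k).1, rfl, fun k i hik => hnext k _ _ _ (hmono hik (hmem i))⟩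

theorem tendsto_zero_of_add_mul_le_succ {E D : ℕ → ℝ} {γ M : ℝ} (hγ : 0 < γ) (hD : ∀ k, 0 ≤ D k)
    (hE : ∀ k, E k + γ * D k ≤ E (k + 1)) (hM : ∀ k, E k ≤ M) : Tendsto D atTop (𝓝 0) := by
  have hmono : Monotone E := monotone_nat_of_le_succ fun k =>
    (le_add_of_nonneg_right (mul_nonneg hγ.le (hD k))).trans (hE k)
  have hlim := tendsto_atTop_ciSup hmono ⟨M, forall_mem_range.2 hM⟩
  have hincr : Tendsto (fun k => γ⁻¹ * (E (k + 1) - E k)) atTop (𝓝 0) := by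
    simpa using ((hlim.comp (tendsto_add_atTop_nat 1)).sub hlim).const_mul γ⁻¹
  refine squeeze_zero hD (fun k => ?_) hincr
  rw [le_inv_mul_iff₀ hγ]
  linarith [hE k]

section AlmostOrthogonal

variable {E : Type*} [NormedAddCommGroup E] [InnerProductSpace ℝ E]

theorem abs_inner_sub_le_of_almost_orthogonal {V : ℕ → E}
    (horth : ∀ k, ∀ i ≤ k, |⟪V (k + 1) - V k, V i⟫| ≤ (1 / 2) ^ k) {k m : ℕ} (hkm : k ≤ m) :
    |⟪V m - V k, V k⟫| ≤ 2 * (1 / 2) ^ k := by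
  have hstep {j : ℕ} (hkj : k ≤ j) (_ : j < m) :
      dist ⟪V j, V k⟫ ⟪V (j + 1), V k⟫ ≤ (1 / 2) ^ j := by
    rw [dist_comm, Real.dist_eq, ← inner_sub_left]
    exact horth j k hkj
  calc |⟪V m - V k, V k⟫| = dist ⟪V k, V k⟫ ⟪V m, V k⟫ := by
        rw [dist_comm, Real.dist_eq, inner_sub_left]
    _ ≤ ∑ j ∈ Finset.Ico k m, (1 / 2 : ℝ) ^ j := dist_le_Ico_sum_of_dist_le hkm hstep
    _ ≤ (1 / 2) ^ k / (1 - 1 / 2) := geom_sum_Ico_le_of_lt_one (by norm_num) (by norm_num)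
    _ = 2 * (1 / 2) ^ k := by ring

theorem cauchySeq_of_almost_orthogonal {V : ℕ → E} (hmono : Monotone fun k => ‖V k‖ ^ 2) {M : ℝ}
    (hM : ∀ k, ‖V k‖ ^ 2 ≤ M)
    (horth : ∀ k, ∀ i ≤ k, |⟪V (k + 1) - V k, V i⟫| ≤ (1 / 2) ^ k) : CauchySeq V := by
  have hbdd : BddAbove (range fun k => ‖V k‖ ^ 2) := ⟨M, forall_mem_range.2 hM⟩
  have hlim := tendsto_atTop_ciSup hmono hbdd
  set L := ⨆ k, ‖V k‖ ^ 2
  have hb : Tendsto (fun k : ℕ => √(L - ‖V k‖ ^ 2 + 4 * (1 / 2) ^ k)) atTop (𝓝 0) := by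
    have hpow := tendsto_pow_atTop_nhds_zero_of_lt_one (r := (1 / 2 : ℝ)) (by norm_num)
      (by norm_num)
    simpa using ((hlim.const_sub L).add (hpow.const_mul 4)).sqrt
  refine cauchySeq_of_le_tendsto_0' _ (fun k m hkm => ?_) hb
  rw [dist_comm, dist_eq_norm]
  refine Real.le_sqrt_of_sq_le ?_
  have hexpand := norm_add_sq_real (V k) (V m - V k)
  rw [add_sub_cancel, real_inner_comm] at hexpand
  have hinner := (abs_le.1 (abs_inner_sub_le_of_almost_orthogonal horth hkm)).1
  linarith [le_ciSup hbdd m]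

end AlmostOrthogonal

section AlmostEverywhere

variable {X E : Type*} [MeasurableSpace X] {μ : Measure X}

theorem exists_ae_tendsto_of_almost_orthogonal [NormedAddCommGroup E] [InnerProductSpace ℝ E]
    [CompleteSpace E] {v : ℕ → X → E} (hv : ∀ k, MemLp (v k) 2 μ)
    (hmono : Monotone fun k => ∫ y, ‖v k y‖ ^ 2 ∂μ) {M : ℝ} (hM : ∀ k, ∫ y, ‖v k y‖ ^ 2 ∂μ ≤ M)
    (horth : ∀ k, ∀ i ≤ k, |∫ y, ⟪v (k + 1) y - v k y, v i y⟫ ∂μ| ≤ (1 / 2) ^ k) :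
    ∃ (w : X → E) (φ : ℕ → ℕ), AEStronglyMeasurable w μ ∧ StrictMono φ ∧
      ∀ᵐ y ∂μ, Tendsto (fun k => v (φ k) y) atTop (𝓝 (w y)) := by
  let V (k : ℕ) : Lp E 2 μ := (hv k).toLp (v k)
  have hcoe (k : ℕ) : V k =ᵐ[μ] v k := (hv k).coeFn_toLp
  have hnorm (k : ℕ) : ‖V k‖ ^ 2 = ∫ y, ‖v k y‖ ^ 2 ∂μ := by
    rw [← real_inner_self_eq_norm_sq, L2.inner_def]
    refine integral_congr_ae ?_
    filter_upwards [hcoe k] with y hy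
    rw [hy, real_inner_self_eq_norm_sq]
  have hinner (i k : ℕ) :
      ⟪V (k + 1) - V k, V i⟫ = ∫ y, ⟪v (k + 1) y - v k y, v i y⟫ ∂μ := by
    rw [L2.inner_def]
    refine integral_congr_ae ?_
    filter_upwards [hcoe k, hcoe (k + 1), hcoe i, Lp.coeFn_sub (V (k + 1)) (V k)]
      with y hk hk' hi hsub
    rw [hsub, Pi.sub_apply, hk, hk', hi]
  obtain ⟨W, hW⟩ := cauchySeq_tendsto_of_complete <| cauchySeq_of_almost_orthogonal (V := V)
    (by simpa only [hnorm] using hmono) (by simpa only [hnorm] using hM)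
    (by simpa only [hinner] using horth)
  obtain ⟨φ, hφ, hae⟩ := (tendstoInMeasure_of_tendsto_Lp hW).exists_seq_tendsto_ae
  refine ⟨W, φ, Lp.aestronglyMeasurable W, hφ, ?_⟩
  filter_upwards [hae, ae_all_iff.2 hcoe] with y hy hcoey
  exact hy.congr fun k => hcoey (φ k)

theorem ae_eq_zero_of_tendsto_of_tendsto_integral {f : ℕ → X → ℝ} {g : X → ℝ}
    (hf : ∀ k, Integrable (f k) μ) (hf0 : ∀ k y, 0 ≤ f k y)
    (hint : Tendsto (fun k => ∫ y, f k y ∂μ) atTop (𝓝 0))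
    (hlim : ∀ᵐ y ∂μ, Tendsto (f · y) atTop (𝓝 (g y))) : g =ᵐ[μ] 0 := by
  have hnorm : Tendsto (fun k => eLpNorm (f k - 0) 1 μ) atTop (𝓝 0) := by
    have hofReal (k : ℕ) : eLpNorm (f k - 0) 1 μ = ENNReal.ofReal (∫ y, f k y ∂μ) := by
      rw [sub_zero, eLpNorm_one_eq_lintegral_enorm,
        ← ofReal_integral_norm_eq_lintegral_enorm (hf k)]
      simp only [Real.norm_of_nonneg (hf0 k _)]
    simpa only [hofReal, ENNReal.ofReal_zero] using ENNReal.tendsto_ofReal hint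
  obtain ⟨φ, hφ, hae⟩ := (tendstoInMeasure_of_tendsto_eLpNorm one_ne_zero
    (fun k => (hf k).aestronglyMeasurable) aestronglyMeasurable_zero hnorm).exists_seq_tendsto_ae
  filter_upwards [hlim, hae] with y hg h0
  exact tendsto_nhds_unique (hg.comp hφ.tendsto_atTop) h0

end AlmostEverywhere

section SaturatingSequence

variable {n : ℕ} {Q : Set (SpaceTime n)} {e : ℝ}

theorem tendsto_stress_of_tendsto_velocity [NeZero n] {ι : Type*} {l : Filter ι} {s : ι → State n}
    (hs : ∀ k, IsStrictState e (s k)) (hsymm : ∀ k, (s k).2.1.IsSymm)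
    (htrace : ∀ k, (s k).2.1.trace = 0) {v : EuclideanSpace ℝ (Fin n)} (hv : ‖v‖ ^ 2 = e)
    (hlim : Tendsto (fun k => (s k).1) l (𝓝 v)) :
    Tendsto (fun k => (s k).2.1) l (𝓝 (Matrix.vecMulVec v.ofLp v.ofLp + (-(e / n)) • 1)) := by
  have hdefect : Tendsto (fun k => energyDefect e (s k)) l (𝓝 0) := by
    refine tendsto_pi_nhds.2 fun i => tendsto_pi_nhds.2 fun j => squeeze_zero_norm (fun k => ?_)
      (show Tendsto (fun k => e - ‖(s k).1‖ ^ 2) l (𝓝 0) by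
        simpa [hv] using (hlim.norm.pow 2).const_sub e)
    rw [← trace_energyDefect e (htrace k)]
    exact abs_apply_le_trace_of_posSemidef ((hs k).posDef (hsymm k)).posSemidef i j
  have hprod : Tendsto (fun k => Matrix.vecMulVec (s k).1.ofLp (s k).1.ofLp) l
      (𝓝 (Matrix.vecMulVec v.ofLp v.ofLp)) :=
    ((show Continuous fun x : EuclideanSpace ℝ (Fin n) => Matrix.vecMulVec x.ofLp x.ofLp by
      fun_prop).tendsto v).comp hlim
  have hsum := (hdefect.add hprod).add_const ((-(e / n)) • (1 : Matrix (Fin n) (Fin n) ℝ))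
  rw [zero_add] at hsum
  refine hsum.congr fun k => ?_
  rw [energyDefect, neg_smul]
  abel

theorem IsSubsolution.norm_velocity_sq_lt [NeZero n] {z : SpaceTime n → State n}
    (hz : IsSubsolution Q e z) (y : SpaceTime n) : ‖(z y).1‖ ^ 2 < e :=
  (hz.isStrictState y).norm_sq_lt (hz.isSymm y) (hz.trace_eq_zero y)

theorem IsSubsolution.integral_norm_sq_le [NeZero n] {z : SpaceTime n → State n}
    (hz : IsSubsolution Q e z) (hQo : IsOpen Q) (hQb : Bornology.IsBounded Q) :
    ∫ y, ‖(z y).1‖ ^ 2 ≤ e * volume.real Q := by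
  rw [← setIntegral_eq_integral_of_forall_compl_eq_zero (s := Q)
    fun y hy => by simp [hz.eq_zero y hy]]
  refine (setIntegral_mono_on hz.integrable_norm_sq.integrableOn
    (integrableOn_const hQb.measure_lt_top.ne) hQo.measurableSet
    fun y _ => (hz.norm_velocity_sq_lt y).le).trans_eq ?_
  rw [setIntegral_const, smul_eq_mul, mul_comm]

/-- A sequence of subsolutions produced by convex integration: the energy grows by a fixed
proportion of the squared energy defect, while the increments of the pressure and their correlations
with the earlier velocities are summable. -/
structure IsSaturatingSequence (Q : Set (SpaceTime n)) (e : ℝ)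
    (z : ℕ → SpaceTime n → State n) : Prop where
  isSubsolution : ∀ k, IsSubsolution Q e (z k)
  zero : z 0 = 0
  abs_pressure_sub_le : ∀ k y, |(z (k + 1) y).2.2 - (z k y).2.2| ≤ (1 / 2) ^ k
  almost_orthogonal : ∀ k, ∀ i ≤ k,
    |∫ y, ⟪(z (k + 1) y).1 - (z k y).1, (z i y).1⟫| ≤ (1 / 2) ^ k
  energy_gain : ∀ k, (∫ y, ‖(z k y).1‖ ^ 2)
    + gainConstant n e / 8 * (∫ y in Q, (e - ‖(z k y).1‖ ^ 2) ^ 2) ≤ ∫ y, ‖(z (k + 1) y).1‖ ^ 2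

theorem exists_isSaturatingSequence (hn : 2 ≤ n) (hQo : IsOpen Q) (hQb : Bornology.IsBounded Q)
    (he : 0 < e) : ∃ z, IsSaturatingSequence Q e z := by
  classical
  have : NeZero n := ⟨by omega⟩
  obtain ⟨f, hf0, hf⟩ := exists_seq_of_forall_finset
    (⟨0, isSubsolution_zero Q he⟩ : {z : SpaceTime n → State n // IsSubsolution Q e z})
    (R := fun k z z' g => (∀ y, |(z'.1 y).2.2 - (z.1 y).2.2| ≤ (1 / 2) ^ k) ∧
      |∫ y, ⟪(z'.1 y).1 - (z.1 y).1, (g.1 y).1⟫| ≤ (1 / 2) ^ k ∧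
      (∫ y, ‖(z.1 y).1‖ ^ 2) + gainConstant n e / 8 * (∫ y in Q, (e - ‖(z.1 y).1‖ ^ 2) ^ 2)
        ≤ ∫ y, ‖(z'.1 y).1‖ ^ 2) fun k z T => by
    obtain ⟨z', hz', hpressure, horth, hgain⟩ := z.2.exists_energy_gain hn hQo hQb he
      (T := T.image fun g y => (g.1 y).1) (Finset.forall_mem_image.2 fun g _ =>
        g.2.continuous_velocity) (ε := (1 / 2) ^ k) (by positivity)
    exact ⟨⟨z', hz'⟩, fun g hg => ⟨hpressure, horth _ (Finset.mem_image_of_mem _ hg), hgain⟩⟩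
  exact ⟨fun k => (f k).1, fun k => (f k).2, congrArg Subtype.val hf0,
    fun k => (hf k k le_rfl).1, fun k i hik => (hf k i hik).2.1, fun k => (hf k k le_rfl).2.2⟩

namespace IsSaturatingSequence

variable {z : ℕ → SpaceTime n → State n}

theorem tendsto_defect [NeZero n] (hz : IsSaturatingSequence Q e z) (hQo : IsOpen Q)
    (hQb : Bornology.IsBounded Q) (he : 0 < e) :
    Tendsto (fun k => ∫ y in Q, (e - ‖(z k y).1‖ ^ 2) ^ 2) atTop (𝓝 0) :=
  tendsto_zero_of_add_mul_le_succ (div_pos (gainConstant_pos he) (by norm_num))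
    (fun _ => integral_nonneg fun _ => sq_nonneg _) hz.energy_gain
    fun k => (hz.isSubsolution k).integral_norm_sq_le hQo hQb

theorem exists_ae_tendsto_velocity [NeZero n] (hz : IsSaturatingSequence Q e z) (hQo : IsOpen Q)
    (hQb : Bornology.IsBounded Q) (he : 0 < e) :
    ∃ (w : SpaceTime n → EuclideanSpace ℝ (Fin n)) (φ : ℕ → ℕ), AEStronglyMeasurable w volume ∧
      StrictMono φ ∧ ∀ᵐ y, Tendsto (fun k => (z (φ k) y).1) atTop (𝓝 (w y)) := by
  refine exists_ae_tendsto_of_almost_orthogonal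
    (fun k => (hz.isSubsolution k).continuous_velocity.memLp_of_hasCompactSupport
      (hz.isSubsolution k).hasCompactSupport_velocity)
    (monotone_nat_of_le_succ fun k => (le_add_of_nonneg_right ?_).trans (hz.energy_gain k))
    (fun k => (hz.isSubsolution k).integral_norm_sq_le hQo hQb) hz.almost_orthogonal
  exact mul_nonneg (div_pos (gainConstant_pos he) (by norm_num)).le
    (integral_nonneg fun _ => sq_nonneg _)

theorem exists_tendsto_pressure (hz : IsSaturatingSequence Q e z) :
    ∃ p : SpaceTime n → ℝ, Measurable p ∧ ∀ y, Tendsto (fun k => (z k y).2.2) atTop (𝓝 (p y)) := by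
  have hconv (y : SpaceTime n) : ∃ a, Tendsto (fun k => (z k y).2.2) atTop (𝓝 a) :=
    cauchySeq_tendsto_of_complete (cauchySeq_of_le_geometric (1 / 2) 1 (by norm_num) fun k => by
      rw [one_mul, dist_comm]
      exact hz.abs_pressure_sub_le k y)
  choose p hp using hconv
  exact ⟨p, measurable_of_tendsto_metrizable
    (fun k => (hz.isSubsolution k).continuous.snd.snd.measurable) (tendsto_pi_nhds.2 hp), hp⟩

theorem abs_pressure_le (hz : IsSaturatingSequence Q e z) (k : ℕ) (y : SpaceTime n) :
    |(z k y).2.2| ≤ 2 := by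
  have hstep {j : ℕ} (_ : j < k) : dist (z j y).2.2 (z (j + 1) y).2.2 ≤ (1 / 2) ^ j := by
    rw [dist_comm]
    exact hz.abs_pressure_sub_le j y
  simpa [hz.zero, Real.dist_eq] using
    (dist_le_range_sum_of_dist_le k hstep).trans (sum_geometric_two_le k)

theorem norm_le [NeZero n] (hz : IsSaturatingSequence Q e z) (k : ℕ) (y : SpaceTime n) :
    ‖z k y‖ ≤ max √e (max (2 * e) 2) := by
  have hsub := hz.isSubsolution k
  exact max_le_max
    ((hsub.isStrictState y).norm_velocity_le (hsub.isSymm y) (hsub.trace_eq_zero y))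
    (max_le_max ((hsub.isStrictState y).norm_stress_le (hsub.isSymm y) (hsub.trace_eq_zero y))
      (hz.abs_pressure_le k y))

theorem ae_norm_sq_eq_of_tendsto [NeZero n] (hz : IsSaturatingSequence Q e z) (hQo : IsOpen Q)
    (hQb : Bornology.IsBounded Q) (he : 0 < e) {φ : ℕ → ℕ} (hφ : StrictMono φ)
    {v : SpaceTime n → EuclideanSpace ℝ (Fin n)}
    (hlim : ∀ᵐ y, Tendsto (fun k => (z (φ k) y).1) atTop (𝓝 (v y))) :
    ∀ᵐ y, y ∈ Q → ‖v y‖ ^ 2 = e := by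
  have hint (k : ℕ) : IntegrableOn (fun y => (e - ‖(z k y).1‖ ^ 2) ^ 2) Q := by
    have hcont := (hz.isSubsolution k).continuous_velocity
    exact (show Continuous fun y => (e - ‖(z k y).1‖ ^ 2) ^ 2 by fun_prop).continuousOn
      |>.integrableOn_compact hQb.isCompact_closure |>.mono_set subset_closure
  have hzero := ae_eq_zero_of_tendsto_of_tendsto_integral (fun k => hint (φ k))
    (fun _ _ => sq_nonneg _) ((hz.tendsto_defect hQo hQb he).comp hφ.tendsto_atTop)
    (g := fun y => (e - ‖v y‖ ^ 2) ^ 2) <| (ae_restrict_of_ae hlim).mono fun y hy =>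
      ((hy.norm.pow 2).const_sub e).pow 2
  filter_upwards [(ae_restrict_iff' hQo.measurableSet).1 hzero] with y hy hyQ
  exact (sub_eq_zero.1 (pow_eq_zero_iff two_ne_zero |>.1 (hy hyQ))).symm

end IsSaturatingSequence

end SaturatingSequence

section EulerSolution

variable {n : ℕ} {Q : Set (SpaceTime n)} {e : ℝ}

theorem IsSaturatingSequence.exists_limit [NeZero n] {z : ℕ → SpaceTime n → State n}
    (hz : IsSaturatingSequence Q e z) (hQo : IsOpen Q) (hQb : Bornology.IsBounded Q)
    (he : 0 < e) :
    ∃ (v : SpaceTime n → EuclideanSpace ℝ (Fin n)) (p : SpaceTime n → ℝ),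
      AEStronglyMeasurable v volume ∧ Measurable p ∧ (∀ y, |p y| ≤ 2) ∧
      (∀ y ∉ Q, v y = 0 ∧ p y = 0) ∧ (∀ᵐ y, y ∈ Q → ‖v y‖ ^ 2 = e) ∧
      IsLinearEulerSolution fun y => (v y, Matrix.vecMulVec (v y).ofLp (v y).ofLp
        + Q.indicator (fun _ => -(e / n)) y • 1, p y) := by
  obtain ⟨w, φ, hw, hφ, hwlim⟩ := hz.exists_ae_tendsto_velocity hQo hQb he
  obtain ⟨p, hp, hplim⟩ := hz.exists_tendsto_pressure
  have hzero (y : SpaceTime n) (hy : y ∉ Q) (k : ℕ) : z k y = 0 :=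
    (hz.isSubsolution k).eq_zero y hy
  have hp0 (y : SpaceTime n) (hy : y ∉ Q) : p y = 0 :=
    tendsto_nhds_unique (hplim y) (by simp [hzero y hy])
  have hvlim : ∀ᵐ y, Tendsto (fun k => (z (φ k) y).1) atTop (𝓝 (Q.indicator w y)) := by
    filter_upwards [hwlim] with y hy
    by_cases hyQ : y ∈ Q
    · rwa [indicator_of_mem hyQ]
    · simp [hyQ, hzero y hyQ]
  have hsat := hz.ae_norm_sq_eq_of_tendsto hQo hQb he hφ hvlim
  refine ⟨Q.indicator w, p, hw.indicator hQo.measurableSet, hp, fun y =>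
    le_of_tendsto (hplim y).abs (.of_forall fun k => hz.abs_pressure_le k y),
    fun y hy => ⟨indicator_of_notMem hy w, hp0 y hy⟩, hsat,
    isLinearEulerSolution_of_tendsto
      (fun k => (hz.isSubsolution (φ k)).toIsLinearEulerSolution)
      (fun k => (hz.isSubsolution (φ k)).continuous)
      (fun k y => hz.norm_le (φ k) y) ?_⟩
  filter_upwards [hvlim, hsat] with y hv hy
  by_cases hyQ : y ∈ Q
  · refine hv.prodMk_nhds (.prodMk_nhds ?_ ((hplim y).comp hφ.tendsto_atTop))
    rw [indicator_of_mem hyQ fun _ => -(e / (n : ℝ))]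
    exact tendsto_stress_of_tendsto_velocity (fun k => (hz.isSubsolution (φ k)).isStrictState y)
      (fun k => (hz.isSubsolution (φ k)).isSymm y)
      (fun k => (hz.isSubsolution (φ k)).trace_eq_zero y) (hy hyQ) hv
  · simp [hyQ, hzero y hyQ, hp0 y hyQ, Prod.mk_zero_zero]

theorem memLp_top_norm_sq {X E : Type*} [MeasurableSpace X] [NormedAddCommGroup E] {μ : Measure X}
    {v : X → E} (hv : MemLp v ⊤ μ) : MemLp (fun y => ‖v y‖ ^ 2) ⊤ μ := by
  simp only [sq]
  exact hv.norm.mul hv.norm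

theorem IsLinearEulerSolution.isDistributionalEulerSolution
    {v : SpaceTime n → EuclideanSpace ℝ (Fin n)} {a p : SpaceTime n → ℝ}
    (hz : IsLinearEulerSolution fun y =>
      (v y, Matrix.vecMulVec (v y).ofLp (v y).ofLp + a y • 1, p y))
    (hv : MemLp v ⊤ volume) (hp : MemLp (p + a) ⊤ volume) :
    IsDistributionalEulerSolution (fun _ => 0) v (p + a) where
  locallyIntegrable_force := locallyIntegrable_const 0
  locallyIntegrable_velocity := hv.locallyIntegrable le_top
  locallyIntegrable_velocity_sq := (memLp_top_norm_sq hv).locallyIntegrable le_top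
  locallyIntegrable_pressure := hp.locallyIntegrable le_top
  momentum φ hφ hφc := by
    have hmom := hz.momentum φ hφ hφc
    simp only [momentumForm_add_smul_one] at hmom
    simpa [momentumForm_apply, Matrix.vecMulVec_apply, timeDeriv, spaceDeriv] using hmom
  incompressible ψ hψ hψc :=
    (integral_congr_ae <| .of_forall fun y =>
      (map_prod_zero_eq_sum (fderiv ℝ ψ y) (v y)).symm).trans (hz.incompressible ψ hψ hψc)

theorem exists_isDistributionalEulerSolution (hn : 2 ≤ n) (hQo : IsOpen Q)
    (hQb : Bornology.IsBounded Q) (he : 0 < e) :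
    ∃ (v : SpaceTime n → EuclideanSpace ℝ (Fin n)) (p : SpaceTime n → ℝ),
      MemLp v ⊤ volume ∧ MemLp p ⊤ volume ∧ IsDistributionalEulerSolution (fun _ => 0) v p ∧
      (∀ y ∉ Q, v y = 0 ∧ p y = 0) ∧ ∀ᵐ y, y ∈ Q → ‖v y‖ ^ 2 = e := by
  have : NeZero n := ⟨by omega⟩
  obtain ⟨z, hz⟩ := exists_isSaturatingSequence hn hQo hQb he
  obtain ⟨v, p, hvm, hpm, hp2, h0, hsat, hsol⟩ := hz.exists_limit hQo hQb he
  have hv : MemLp v ⊤ volume := memLp_top_of_bound hvm √e <| hsat.mono fun y hy => by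
    by_cases hyQ : y ∈ Q
    · exact Real.le_sqrt_of_sq_le (hy hyQ).le
    · simp [(h0 y hyQ).1]
  have hp : MemLp (p + Q.indicator fun _ => -(e / (n : ℝ))) ⊤ volume :=
    (memLp_top_of_bound hpm.aestronglyMeasurable 2 (.of_forall hp2)).add
      ((memLp_top_const _).indicator hQo.measurableSet)
  exact ⟨v, _, hv, hp, hsol.isDistributionalEulerSolution hv hp,
    fun y hy => ⟨(h0 y hy).1, by simp [(h0 y hy).2, hy]⟩, hsat⟩

end EulerSolution

section Slices

variable {X T E : Type*} [MeasurableSpace X] [MeasurableSpace T] [NormedAddCommGroup E]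
  {μ : Measure X} {ν : Measure T} [SFinite μ] [SFinite ν] {v : X × T → E} {e : ℝ}
  {Ω : Set X} {I : Set T}

theorem ae_integral_norm_sq_slice_eq (hΩ : MeasurableSet Ω) (h0 : ∀ y ∉ Ω ×ˢ I, v y = 0)
    (he : ∀ᵐ y ∂μ.prod ν, y ∈ Ω ×ˢ I → ‖v y‖ ^ 2 = e) :
    ∀ᵐ t ∂ν, t ∈ I → ∫ x, ‖v (x, t)‖ ^ 2 ∂μ = e * μ.real Ω := by
  have hswap : ∀ᵐ y ∂ν.prod μ, y.swap ∈ Ω ×ˢ I → ‖v y.swap‖ ^ 2 = e :=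
    Measure.measurePreserving_swap.quasiMeasurePreserving.ae he
  filter_upwards [Measure.ae_ae_of_ae_prod hswap] with t ht htI
  have hslice : ∀ᵐ x ∂μ, x ∈ Ω → ‖v (x, t)‖ ^ 2 = e :=
    ht.mono fun x hx hxΩ => hx ⟨hxΩ, htI⟩
  rw [← setIntegral_eq_integral_of_forall_compl_eq_zero (s := Ω)
    fun x hx => by simp [h0 (x, t) fun h => hx h.1], setIntegral_congr_ae hΩ hslice,
    setIntegral_const, smul_eq_mul, mul_comm]

end Slices

theorem not_ae_eq_zero_of_norm_sq_eq {X E : Type*} [MeasurableSpace X] [NormedAddCommGroup E]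
    {μ : Measure X} {v : X → E} {e : ℝ} {Q : Set X} (hQ : μ Q ≠ 0) (he : e ≠ 0)
    (hv : ∀ᵐ y ∂μ, y ∈ Q → ‖v y‖ ^ 2 = e) : ¬ v =ᵐ[μ] 0 := fun hv0 =>
  hQ <| measure_eq_zero_iff_ae_notMem.2 <| by
    filter_upwards [hv, hv0] with y hy hy0 hyQ
    exact he (by simpa [hy0] using (hy hyQ).symm)

theorem theorem2 (n : ℕ) (hn : 2 ≤ n) :
    ∃ (v : SpaceTime n → EuclideanSpace ℝ (Fin n)) (p : SpaceTime n → ℝ),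
      MemLp v ⊤ volume ∧ MemLp p ⊤ volume ∧
      IsDistributionalEulerSolution (fun _ => 0) v p ∧
      ¬ (v =ᵐ[volume] 0) ∧
      HasCompactSupport v ∧ HasCompactSupport p ∧
      (∀ᵐ t : ℝ, t ∈ Set.Ioo (-1 : ℝ) 1 →
        ∫ x : EuclideanSpace ℝ (Fin n), ‖v (x, t)‖ ^ 2 = 1) ∧
      (∀ (x : EuclideanSpace ℝ (Fin n)) (t : ℝ), 1 < |t| → v (x, t) = 0) := by
  set Ω := Metric.ball (0 : EuclideanSpace ℝ (Fin n)) 1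
  have hΩ : 0 < volume.real Ω :=
    ENNReal.toReal_pos (Metric.measure_ball_pos _ _ one_pos).ne' measure_ball_lt_top.ne
  have hQo : IsOpen (Ω ×ˢ Ioo (-1 : ℝ) 1) := Metric.isOpen_ball.prod isOpen_Ioo
  have hQb : Bornology.IsBounded (Ω ×ˢ Ioo (-1 : ℝ) 1) :=
    Metric.isBounded_ball.prod (Metric.isBounded_Ioo _ _)
  have hQ0 : (volume : Measure (SpaceTime n)) (Ω ×ˢ Ioo (-1 : ℝ) 1) ≠ 0 :=
    (hQo.measure_pos volume ⟨(0, 0), by simp [Ω]⟩).ne'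
  obtain ⟨v, p, hv, hp, hsol, h0, hsat⟩ :=
    exists_isDistributionalEulerSolution hn hQo hQb (inv_pos.2 hΩ)
  refine ⟨v, p, hv, hp, hsol, not_ae_eq_zero_of_norm_sq_eq hQ0 (inv_pos.2 hΩ).ne' hsat,
    .intro hQb.isCompact_closure fun y hy => (h0 y fun h => hy (subset_closure h)).1,
    .intro hQb.isCompact_closure fun y hy => (h0 y fun h => hy (subset_closure h)).2, ?_,
    fun x t ht => (h0 (x, t) fun h => ht.not_ge (abs_lt.2 h.2).le).1⟩
  have hslice := ae_integral_norm_sq_slice_eq (Ω := Ω) measurableSet_ball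
    (fun y hy => (h0 y hy).1) hsat
  rwa [inv_mul_cancel₀ hΩ.ne'] at hslice
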